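/- Let $\mathbb D=\{z\in\mathbb C:|z|<1\}$, and let $\angle\lim$ denote the angular (non-tangential) limit. A one-parameter semigroup is a family $(\phi_t)_{t\ge0}$ of holomorphic self-maps of $\mathbb D$ with $\phi_0=\mathrm{id}$, $\phi_s\circ\phi_t=\phi_{s+t}$ and $\phi_t(z)\to z$ as $t\to0^+$ for every $z\in\mathbb D$. Its infinitesimal generator is the holomorphic function $G:\mathbb D\to\mathbb C$ with $\frac{d}{dt}\phi_t(z)=G(\phi_t(z))$ for all $z\in\mathbb D$, $t\ge0$. The Denjoy--Wolff point (DW-point) of a holomorphic $\varphi:\mathbb D\to\mathbb D$, $\varphi\ne\mathrm{id}$, is its unique fixed point $\tau\in\mathbb D$ if it has one, and otherwise the unique boundary regular fixed point $\tau\in\partial\mathbb D$ with $\varphi'(\tau)\le1$; here $\sigma\in\partial\mathbb D$ is a boundary regular fixed point (BRFP) of $\varphi$ if $\angle\lim_{z\to\sigma}\varphi(z)=\sigma$ and $\varphi'(\sigma):=\angle\lim_{z\to\sigma}\frac{\varphi(z)-\sigma}{z-\sigma}$ exists finitely. The DW-point of a non-trivial semigroup $(\phi_t)$ is the common DW-point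 of all $\phi_t\neq\mathrm{id}$, and $\sigma$ is a BRFP of $(\phi_t)$ if it is a BRFP of every $\phi_t$, $t\ge0$. The spectral value of the semigroup at a BRFP $\sigma$ is $\angle\lim_{z\to\sigma}\frac{G(z)}{\sigma-z}$. A Herglotz function is a holomorphic $p:\mathbb D\to\mathbb C$ with $\operatorname{Re}p\ge0$; for $\sigma\in\partial\mathbb D$ put $p^\star(\sigma):=\angle\lim_{z\to\sigma}(1-\bar\sigma z)p(z)$ (this limit always exists). Let $n\ge1$, let $\sigma_1,\dots,\sigma_n\in\partial\mathbb D$ be pairwise distinct, $F=\{\sigma_1,\dots,\sigma_n\}$, let $\tau\in\overline{\mathbb D}\setminus F$ and $\Lambda=(\lambda_1,\dots,\lambda_n)\in(-\infty,0)^n$. Let $\mathsf{Gen}_\tau(F,\Lambda)$ be the set of infinitesimal generators $G$ that are either identically zero or generate a semigroup with DW-point $\tau$, and whose semigroup has BRFPs $\sigma_1,\dots,\sigma_n$ with spectral values $\lambda'_1,\dots,\lambda'_n$ satisfying $\lambda_k\le\lambda'_k\le0$ for all $k$. Let $\mathsf{Gen}'_\tau(F,\Lambda)$ be the subset of those $G$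 for which $\lambda'_k=\lambda_k$ for all $k$. Put $$p_0(z;F,\Lambda):=\sum_{k=1}^n\alpha_k\frac{\sigma_k+z}{\sigma_k-z},\qquad \alpha_k:=\frac{|\tau-\sigma_k|^2}{2|\lambda_k|}.$$ **Theorem.** Let $G:\mathbb D\to\mathbb C$. (A) $G\in\mathsf{Gen}_\tau(F,\Lambda)$ and $G\not\equiv0$ if and only if there exists a Herglotz function $p$ such that $$G(z)=\frac{(\tau-z)(1-\bar\tau z)}{p(z)+p_0(z;F,\Lambda)}\quad\text{for all }z\in\mathbb D.\qquad(*)$$ (B) $G\in\mathsf{Gen}'_\tau(F,\Lambda)$ if and only if $(*)$ holds with some Herglotz function $p$ satisfying $p^\star(\sigma_k)=0$ for all $k=1,\dots,n$. -/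

import Mathlib

open Filter Topology Metric
open scoped ComplexConjugate

namespace DiskSemigroup

/-- The open unit disk. Functions on the disk are modelled by functions `ℂ → ℂ` of which only the
values on `𝔻` are used. -/
abbrev disk : Set ℂ := ball (0 : ℂ) 1

/-- The Stolz (non-tangential approach) region of aperture `M` at the boundary point `σ`. -/
def stolz (σ : ℂ) (M : ℝ) : Set ℂ := {z | ‖z‖ < 1 ∧ ‖σ - z‖ < M * (1 - ‖z‖)}

/-- The filter of non-tangential approach to `σ ∈ ∂𝔻`: a function has angular limit `l` at `σ` iff
it tends to `l` as `z → σ` inside every Stolz region at `σ`. -/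
noncomputable def angular (σ : ℂ) : Filter ℂ := ⨆ M : ℝ, 𝓝[stolz σ M] σ

/-- `p` is a Herglotz function. -/
structure IsHerglotz (p : ℂ → ℂ) : Prop where
  holo : DifferentiableOn ℂ p disk
  re_nonneg : ∀ z ∈ disk, 0 ≤ (p z).re

/-- `p⋆(σ) = c`, that is, `(1 - conj σ * z) * p z` has angular limit `c` at `σ`. -/
def HasStar (p : ℂ → ℂ) (σ c : ℂ) : Prop :=
  Tendsto (fun z => (1 - conj σ * z) * p z) (angular σ) (𝓝 c)

/-- `σ ∈ ∂𝔻` is a boundary fixed point of `f` with (finite) angular derivative `a`. -/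
structure HasBRFPWithDeriv (f : ℂ → ℂ) (σ a : ℂ) : Prop where
  norm_eq : ‖σ‖ = 1
  fixed : Tendsto f (angular σ) (𝓝 σ)
  angularDeriv : Tendsto (fun z => (f z - σ) / (z - σ)) (angular σ) (𝓝 a)

/-- `σ` is a boundary regular fixed point of `f`. -/
def IsBRFP (f : ℂ → ℂ) (σ : ℂ) : Prop := ∃ a : ℂ, HasBRFPWithDeriv f σ a

/-- `τ` is the Denjoy--Wolff point of the holomorphic self-map `f ≠ id` of the disk. -/
def IsDWPoint (f : ℂ → ℂ) (τ : ℂ) : Prop :=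
  (τ ∈ disk ∧ f τ = τ ∧ (∀ w ∈ disk, f w = w → w = τ) ∧ ‖deriv f τ‖ ≤ 1) ∨
  ((∀ w ∈ disk, f w ≠ w) ∧ ∃ a : ℝ, HasBRFPWithDeriv f τ a ∧ a ≤ 1)

/-- `(φ t)`, `t ≥ 0`, is a one-parameter semigroup of holomorphic self-maps of the disk. -/
structure IsSemigroup (φ : ℝ → ℂ → ℂ) : Prop where
  holo : ∀ t, 0 ≤ t → DifferentiableOn ℂ (φ t) disk
  mapsTo : ∀ t, 0 ≤ t → Set.MapsTo (φ t) disk disk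
  zero : ∀ z ∈ disk, φ 0 z = z
  add : ∀ s t, 0 ≤ s → 0 ≤ t → ∀ z ∈ disk, φ (s + t) z = φ s (φ t z)
  continuous_zero : ∀ z ∈ disk, Tendsto (fun t => φ t z) (𝓝[>] 0) (𝓝 z)

/-- `G` is the infinitesimal generator of the one-parameter semigroup `φ`. -/
structure IsGeneratorOf (G : ℂ → ℂ) (φ : ℝ → ℂ → ℂ) : Prop where
  semigroup : IsSemigroup φ
  holo : DifferentiableOn ℂ G disk
  flow : ∀ z ∈ disk, ∀ t, 0 ≤ t →
    HasDerivWithinAt (fun s => φ s z) (G (φ t z)) (Set.Ici 0) t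

/-- `τ` is the Denjoy--Wolff point of the non-trivial one-parameter semigroup `φ`: it is the
Denjoy--Wolff point of every element different from the identity. -/
def IsSemigroupDWPoint (φ : ℝ → ℂ → ℂ) (τ : ℂ) : Prop :=
  (∃ t, 0 < t ∧ ¬ Set.EqOn (φ t) id disk) ∧
  ∀ t, 0 < t → ¬ Set.EqOn (φ t) id disk → IsDWPoint (φ t) τ

/-- `σ` is a boundary regular fixed point of the one-parameter semigroup `φ`. -/
def IsSemigroupBRFP (φ : ℝ → ℂ → ℂ) (σ : ℂ) : Prop := ∀ t, 0 ≤ t → IsBRFP (φ t) σ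

/-- `l` is the spectral value, at the boundary regular fixed point `σ`, of the one-parameter
semigroup generated by `G`. -/
def HasSpectralValue (G : ℂ → ℂ) (σ : ℂ) (l : ℝ) : Prop :=
  Tendsto (fun z => G z / (σ - z)) (angular σ) (𝓝 (l : ℂ))

/-- The class `Gen_τ(F, Λ)`. The zero generator is, by convention, admitted for every `τ`. -/
def Gen {n : ℕ} (τ : ℂ) (σ : Fin n → ℂ) (lam : Fin n → ℝ) : Set (ℂ → ℂ) :=
  {G | ∃ φ : ℝ → ℂ → ℂ, IsGeneratorOf G φ ∧
    (Set.EqOn G 0 disk ∨ IsSemigroupDWPoint φ τ) ∧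
    ∀ k, IsSemigroupBRFP φ (σ k) ∧
      ∃ l : ℝ, HasSpectralValue G (σ k) l ∧ lam k ≤ l ∧ l ≤ 0}

/-- The class `Gen'_τ(F, Λ)`: the spectral values are exactly the given ones. -/
def Gen' {n : ℕ} (τ : ℂ) (σ : Fin n → ℂ) (lam : Fin n → ℝ) : Set (ℂ → ℂ) :=
  {G | G ∈ Gen τ σ lam ∧ ∀ k, HasSpectralValue G (σ k) (lam k)}

/-- The coefficient `α_k = |τ - σ_k|² / (2 |λ_k|)`. -/
noncomputable def alpha (τ σ : ℂ) (l : ℝ) : ℝ := ‖τ - σ‖ ^ 2 / (2 * |l|)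

/-- The function `p_0(z; F, Λ)`. -/
noncomputable def p0 {n : ℕ} (τ : ℂ) (σ : Fin n → ℂ) (lam : Fin n → ℝ) (z : ℂ) : ℂ :=
  ∑ k, (alpha τ (σ k) (lam k) : ℂ) * ((σ k + z) / (σ k - z))

/-- The representation `G(z) = (τ - z)(1 - conj τ * z) / (p(z) + p_0(z; F, Λ))` on the disk. -/
def Represents {n : ℕ} (τ : ℂ) (σ : Fin n → ℂ) (lam : Fin n → ℝ) (p G : ℂ → ℂ) : Prop :=
  ∀ z ∈ disk, G z = (τ - z) * (1 - conj τ * z) / (p z + p0 τ σ lam z)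

end DiskSemigroup

/-! By the Berkson–Porta formula, a nonzero `G` generates a semigroup with DW-point `τ` exactly when
`G z = (τ - z)(1 - conj τ z) q z` with `q` Herglotz and not identically zero. Such a `q` has no
zeros (Harnack), so `P = 1/q` is again Herglotz, and the theorem becomes a statement about the atoms
of `P`.

If `P⋆(σ) = 2m`, then `(1 - conj σ z) P z · G z / (σ - z) = conj σ (τ - z)(1 - conj τ z)`, which
tends to `-|τ - σ|²`. Hence a spectral value `l` of `G` at `σ` satisfies `2 m l = -|τ - σ|² = 2 α
λ`, and `λ ≤ l` means that the atom `m` is at least `α`. Removing the atoms `α_k` from `P` leaves a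
Herglotz function `p`; its atom at `σ_k` is `m_k - α_k`, so equality of spectral values is the
condition `p⋆(σ_k) = 0`.

Atoms are handled without Herglotz measures: the mass at `σ` is the infimum of `Re p` over the
Poisson kernel (`IsHerglotz.exists_star`). The converse also needs a semigroup. A field in
Berkson–Porta form contracts the hyperbolic metric infinitesimally, so its trajectories cannot reach
the circle in finite time and the flow exists (`exists_isGeneratorOf`). Integrating `G z / (σ - z)`
along trajectories turns a finite spectral value into an angular derivative
(`IsGeneratorOf.hasBRFPWithDeriv`). Monotonicity of the pseudo-hyperbolic distance to `τ`, or of the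
Poisson kernel at `τ`, identifies the DW-point and also yields the Berkson–Porta formula. -/

namespace DiskSemigroup

/-! ### Schwarz–Pick inequalities for self-maps of the disk -/

theorem mem_disk {z : ℂ} : z ∈ disk ↔ ‖z‖ < 1 := mem_ball_zero_iff

theorem isOpen_disk : IsOpen disk := isOpen_ball

theorem norm_sq_one_sub_conj_mul_sub (z w : ℂ) :
    ‖1 - conj w * z‖ ^ 2 - ‖z - w‖ ^ 2 = (1 - ‖z‖ ^ 2) * (1 - ‖w‖ ^ 2) := by
  simp only [Complex.sq_norm, Complex.normSq_apply, Complex.sub_re, Complex.sub_im,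
    Complex.mul_re, Complex.mul_im, Complex.conj_re, Complex.conj_im, Complex.one_re,
    Complex.one_im]
  ring

theorem one_sub_norm_sq_pos {z : ℂ} (hz : ‖z‖ < 1) : 0 < 1 - ‖z‖ ^ 2 := by
  nlinarith [norm_nonneg z]

theorem norm_sub_lt_norm_one_sub {z w : ℂ} (hz : ‖z‖ < 1) (hw : ‖w‖ < 1) :
    ‖z - w‖ < ‖1 - conj w * z‖ := by
  have h := norm_sq_one_sub_conj_mul_sub z w
  have := mul_pos (one_sub_norm_sq_pos hz) (one_sub_norm_sq_pos hw)
  exact lt_of_pow_lt_pow_left₀ 2 (norm_nonneg _) (by linarith)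

theorem one_sub_conj_mul_ne_zero {z w : ℂ} (hz : ‖z‖ < 1) (hw : ‖w‖ ≤ 1) :
    1 - conj w * z ≠ 0 := by
  intro h
  have h1 : ‖conj w * z‖ = 1 := by rw [← sub_eq_zero.1 h]; simp
  rw [norm_mul, Complex.norm_conj] at h1
  nlinarith [norm_nonneg z, norm_nonneg w]

theorem norm_mobius_lt_one {z w : ℂ} (hz : ‖z‖ < 1) (hw : ‖w‖ < 1) :
    ‖(z - w) / (1 - conj w * z)‖ < 1 := by
  have h := norm_sub_lt_norm_one_sub hz hw
  rw [norm_div, div_lt_one ((norm_nonneg _).trans_lt h)]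
  exact h

/-- The **Schwarz–Pick lemma**. -/
theorem schwarz_pick {f : ℂ → ℂ} (hf : DifferentiableOn ℂ f disk) (hm : Set.MapsTo f disk disk)
    {z w : ℂ} (hz : z ∈ disk) (hw : w ∈ disk) :
    ‖f z - f w‖ * ‖1 - conj w * z‖ ≤ ‖1 - conj (f w) * f z‖ * ‖z - w‖ := by
  have hz' := mem_disk.1 hz
  have hw' := mem_disk.1 hw
  have hfw := mem_disk.1 (hm hw)
  have hfz := mem_disk.1 (hm hz)
  -- The automorphism of the disk taking `0` to `w`. After composing with it and moving `f w` to
  -- `0`, the classical Schwarz lemma applies to `g`.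
  set m : ℂ → ℂ := fun ζ => (ζ - -w) / (1 - conj (-w) * ζ) with hmdef
  have hm1 : Set.MapsTo m disk disk := fun ζ hζ =>
    mem_disk.2 (norm_mobius_lt_one (mem_disk.1 hζ) (by simpa using hw'))
  have hmd : DifferentiableOn ℂ m disk := by
    intro ζ hζ
    have := one_sub_conj_mul_ne_zero (w := -w) (mem_disk.1 hζ) (by simpa using hw'.le)
    refine DifferentiableAt.differentiableWithinAt ?_
    exact DifferentiableAt.div (by fun_prop) (by fun_prop) this
  set g : ℂ → ℂ := fun ζ => (f (m ζ) - f w) / (1 - conj (f w) * f (m ζ)) with hg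
  have hgd : DifferentiableOn ℂ g (ball 0 1) := by
    have hfm : DifferentiableOn ℂ (fun ζ => f (m ζ)) disk := hf.comp hmd hm1
    refine DifferentiableOn.div (hfm.sub_const _) ((hfm.const_mul _).const_sub _) ?_
    intro ζ hζ
    exact one_sub_conj_mul_ne_zero (mem_disk.1 (hm (hm1 hζ))) hfw.le
  have hgm : Set.MapsTo g (ball 0 1) (closedBall 0 1) := fun ζ hζ =>
    mem_closedBall_zero_iff.2 (norm_mobius_lt_one (mem_disk.1 (hm (hm1 hζ))) hfw).le
  have hg0 : g 0 = 0 := by simp [hg, hmdef]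
  have hne := one_sub_conj_mul_ne_zero hz' hw'.le
  have hmz : m ((z - w) / (1 - conj w * z)) = z := by
    have h1 : (1 : ℂ) - conj w * w ≠ 0 := one_sub_conj_mul_ne_zero hw' hw'.le
    have h2 : 1 - conj (-w) * ((z - w) / (1 - conj w * z)) = (1 - conj w * w) / (1 - conj w * z) := by
      simp only [map_neg]; field_simp; ring
    have h3 : (z - w) / (1 - conj w * z) - -w = z * (1 - conj w * w) / (1 - conj w * z) := by
      rw [eq_div_iff hne, sub_mul, div_mul_cancel₀ _ hne]; ring
    simp only [hmdef]
    rw [h2, h3, div_div_div_cancel_right₀ hne, mul_div_cancel_right₀ _ h1]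
  have key := Complex.norm_le_norm_of_mapsTo_ball hgd hgm hg0 (norm_mobius_lt_one hz' hw')
  simp only [hg, hmz, norm_div] at key
  have p1 : 0 < ‖1 - conj w * z‖ := norm_pos_iff.2 hne
  have p2 : 0 < ‖1 - conj (f w) * f z‖ := norm_pos_iff.2 (one_sub_conj_mul_ne_zero hfz hfw.le)
  rw [div_le_div_iff₀ p2 p1] at key
  linarith [mul_comm ‖z - w‖ ‖1 - conj (f w) * f z‖]

/-- Schwarz–Pick against the base point `0`; the `4` bounds `(1 + ‖f z‖)(1 + ‖f 0‖)`. Since the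
constant depends only on `f 0`, the bound later controls the distance to the circle uniformly along
a flow. -/
theorem one_sub_norm_le_of_mapsTo {f : ℂ → ℂ} (hf : DifferentiableOn ℂ f disk)
    (hm : Set.MapsTo f disk disk) {z : ℂ} (hz : z ∈ disk) :
    (1 - ‖z‖) * (1 - ‖f 0‖) ≤ 4 * (1 - ‖f z‖) := by
  have h0 : (0 : ℂ) ∈ disk := by simp
  have h := schwarz_pick hf hm hz h0
  simp only [map_zero, zero_mul, sub_zero, norm_one, mul_one] at h
  have hz1 := mem_disk.1 hz
  have hf0 := mem_disk.1 (hm h0)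
  have hfz := mem_disk.1 (hm hz)
  have h2 := norm_sq_one_sub_conj_mul_sub (f z) (f 0)
  have h3 : 1 - ‖f 0‖ ≤ ‖1 - conj (f 0) * f z‖ := by
    have := norm_sub_norm_le (1 : ℂ) (conj (f 0) * f z)
    rw [norm_one, norm_mul, Complex.norm_conj] at this
    nlinarith [norm_nonneg (f 0), norm_nonneg (f z)]
  set A := ‖1 - conj (f 0) * f z‖
  have h4 : ‖f z - f 0‖ ^ 2 ≤ (A * ‖z‖) ^ 2 := pow_le_pow_left₀ (norm_nonneg _) h 2
  have h5 : (1 - ‖f 0‖) ^ 2 ≤ A ^ 2 := pow_le_pow_left₀ (by linarith) h3 2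
  have h6 : (1 - ‖f 0‖) ^ 2 * (1 - ‖z‖ ^ 2) ≤ (1 - ‖f z‖ ^ 2) * (1 - ‖f 0‖ ^ 2) := by
    have := mul_le_mul_of_nonneg_right h5 (one_sub_norm_sq_pos hz1).le
    nlinarith
  have h7 : (1 - ‖f 0‖) * (1 - ‖z‖ ^ 2) ≤ (1 - ‖f z‖ ^ 2) * (1 + ‖f 0‖) := by
    have hpos : 0 < 1 - ‖f 0‖ := by linarith
    refine le_of_mul_le_mul_left ?_ hpos
    nlinarith
  have h8 : (1 - ‖f z‖ ^ 2) * (1 + ‖f 0‖) ≤ 4 * (1 - ‖f z‖) := by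
    have : (1 + ‖f z‖) * (1 + ‖f 0‖) ≤ 4 := by nlinarith [norm_nonneg (f 0), norm_nonneg (f z)]
    have := mul_le_mul_of_nonneg_left this (show 0 ≤ 1 - ‖f z‖ by linarith)
    nlinarith
  have h9 : (1 - ‖z‖) * (1 - ‖f 0‖) ≤ (1 - ‖f 0‖) * (1 - ‖z‖ ^ 2) := by
    have : 0 ≤ (1 - ‖f 0‖) * (‖z‖ * (1 - ‖z‖)) :=
      mul_nonneg (by linarith) (mul_nonneg (norm_nonneg _) (by linarith))
    nlinarith
  linarith

/-! ### Schwarz–Pick and Harnack inequalities for Herglotz functions -/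

/-- The Schwarz–Pick lemma for holomorphic functions with non-negative real part. -/
theorem IsHerglotz.schwarz_pick {p : ℂ → ℂ} (hp : IsHerglotz p) {z w : ℂ} (hz : z ∈ disk)
    (hw : w ∈ disk) :
    ‖p z - p w‖ * ‖1 - conj w * z‖ ≤ ‖p z + conj (p w)‖ * ‖z - w‖ := by
  -- The shift by `ε` makes the real part strictly positive, so the Cayley transform `f` lands in
  -- the open disk; `ε → 0` at the end.
  have key : ∀ ε : ℝ, 0 < ε →
      ‖p z - p w‖ * ‖1 - conj w * z‖ ≤ ‖p z + conj (p w) + 2 * ε‖ * ‖z - w‖ := by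
    intro ε hε
    have hne : ∀ ζ ∈ disk, p ζ + ε + 1 ≠ 0 := by
      intro ζ hζ h
      have := congrArg Complex.re h
      simp at this
      linarith [hp.re_nonneg ζ hζ]
    set f : ℂ → ℂ := fun ζ => (p ζ + ε - 1) / (p ζ + ε + 1) with hf
    have hfd : DifferentiableOn ℂ f disk :=
      DifferentiableOn.div ((hp.holo.add_const _).sub_const _) ((hp.holo.add_const _).add_const _)
        hne
    have hfm : Set.MapsTo f disk disk := by
      intro ζ hζ
      have h0 := hp.re_nonneg ζ hζ
      rw [mem_disk, hf, norm_div, div_lt_one (norm_pos_iff.2 (hne ζ hζ))]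
      refine lt_of_pow_lt_pow_left₀ 2 (norm_nonneg _) ?_
      simp only [Complex.sq_norm, Complex.normSq_apply, Complex.sub_re, Complex.sub_im,
        Complex.add_re, Complex.add_im, Complex.ofReal_re, Complex.ofReal_im, Complex.one_re,
        Complex.one_im]
      nlinarith
    have h := DiskSemigroup.schwarz_pick hfd hfm hz hw
    have hA := hne z hz
    have hB := hne w hw
    have hB' : conj (p w) + ε + 1 ≠ 0 := by
      intro h0
      apply hB
      have := congrArg conj h0
      simpa using this
    have e1 : f z - f w = 2 * (p z - p w) / ((p z + ε + 1) * (p w + ε + 1)) := by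
      simp only [hf]; field_simp; ring
    have e2 : 1 - conj (f w) * f z
        = 2 * (p z + conj (p w) + 2 * ε) / ((p z + ε + 1) * (conj (p w) + ε + 1)) := by
      simp only [hf, map_div₀, map_add, map_sub, Complex.conj_ofReal, map_one]; field_simp; ring
    have e3 : ‖conj (p w) + ε + 1‖ = ‖p w + ε + 1‖ := by
      rw [← Complex.norm_conj]; simp
    rw [e1, e2, norm_div, norm_div, norm_mul (p z + ε + 1), norm_mul (p z + ε + 1), e3] at h
    have hD : 0 < ‖p z + ε + 1‖ * ‖p w + ε + 1‖ :=
      mul_pos (norm_pos_iff.2 hA) (norm_pos_iff.2 hB)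
    rw [div_mul_eq_mul_div, div_mul_eq_mul_div, div_le_div_iff_of_pos_right hD] at h
    simp only [norm_mul, Complex.norm_ofNat] at h
    linarith
  have hlim : Tendsto (fun ε : ℝ => ‖p z + conj (p w) + 2 * ε‖ * ‖z - w‖) (𝓝[>] 0)
      (𝓝 (‖p z + conj (p w) + 2 * (0 : ℝ)‖ * ‖z - w‖)) := by
    refine tendsto_nhdsWithin_of_tendsto_nhds (Continuous.tendsto ?_ _)
    fun_prop
  simp only [Complex.ofReal_zero, mul_zero, add_zero] at hlim
  exact ge_of_tendsto hlim (eventually_mem_nhdsWithin.mono fun ε hε => key ε hε)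

/-- A Harnack-type inequality. -/
theorem IsHerglotz.norm_sub_le {p : ℂ → ℂ} (hp : IsHerglotz p) {z w : ℂ} (hz : z ∈ disk)
    (hw : w ∈ disk) :
    ‖p z - p w‖ * ((1 - ‖z‖ ^ 2) * (1 - ‖w‖ ^ 2)) ≤ 4 * (p w).re * ‖1 - conj w * z‖ ^ 2 := by
  have h := hp.schwarz_pick hz hw
  have hlt := norm_sub_lt_norm_one_sub (mem_disk.1 hz) (mem_disk.1 hw)
  have h1 : ‖p z + conj (p w)‖ ≤ ‖p z - p w‖ + 2 * (p w).re := by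
    have e : p z + conj (p w) = (p z - p w) + (2 * (p w).re : ℝ) := by
      rw [← Complex.add_conj]; ring
    rw [e]
    refine (norm_add_le _ _).trans ?_
    rw [Complex.norm_real, Real.norm_of_nonneg (by linarith [hp.re_nonneg w hw])]
  rw [← norm_sq_one_sub_conj_mul_sub]
  have hB := hp.re_nonneg w hw
  set a := ‖1 - conj w * z‖
  set d := ‖z - w‖
  set X := ‖p z - p w‖
  have hd : 0 ≤ d := norm_nonneg _
  have hX : 0 ≤ X := norm_nonneg _
  -- The triangle inequality lets `X` be absorbed on the left. Multiplying by `a + d` then produces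
  -- `a² - d²`, and `d ≤ a` gives the factor `2 a²`.
  have h2 : X * (a - d) ≤ 2 * (p w).re * d := by
    have := mul_le_mul_of_nonneg_right h1 hd
    nlinarith
  have h3 := mul_le_mul_of_nonneg_right h2 (show 0 ≤ a + d by linarith)
  have h4 : d * (a + d) ≤ 2 * a ^ 2 := by nlinarith
  have h5 := mul_le_mul_of_nonneg_left h4 (show 0 ≤ 2 * (p w).re by linarith)
  nlinarith

/-- At a zero `w` the right-hand side of the Harnack bound vanishes. This is what permits passing to
the reciprocal of a nonzero Herglotz function. -/
theorem IsHerglotz.eqOn_zero {p : ℂ → ℂ} (hp : IsHerglotz p) {w : ℂ} (hw : w ∈ disk)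
    (h0 : p w = 0) : Set.EqOn p 0 disk := by
  intro z hz
  have h := hp.norm_sub_le hz hw
  have h1 := mul_pos (one_sub_norm_sq_pos (mem_disk.1 hz)) (one_sub_norm_sq_pos (mem_disk.1 hw))
  simp only [h0, sub_zero, Complex.zero_re, mul_zero, zero_mul] at h
  have : ‖p z‖ ≤ 0 := by
    by_contra hc
    push Not at hc
    exact absurd h (not_le.2 (mul_pos hc h1))
  simpa using this

/-- Schwarz–Pick divided by `‖z - w‖`, in the limit `z → w`. -/
theorem IsHerglotz.norm_deriv_le {p : ℂ → ℂ} (hp : IsHerglotz p) {w : ℂ} (hw : w ∈ disk) :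
    ‖deriv p w‖ * (1 - ‖w‖ ^ 2) ≤ 2 * (p w).re := by
  have hda : HasDerivAt p (deriv p w) w :=
    (hp.holo.differentiableAt (isOpen_disk.mem_nhds hw)).hasDerivAt
  have hsl := (hasDerivAt_iff_tendsto_slope.1 hda).norm
  have hid : Tendsto (fun z : ℂ => z) (𝓝[≠] w) (𝓝 w) := tendsto_nhdsWithin_of_tendsto_nhds tendsto_id
  have hcont : Tendsto p (𝓝[≠] w) (𝓝 (p w)) := hda.continuousAt.tendsto.mono_left nhdsWithin_le_nhds
  have h1 : Tendsto (fun z => ‖slope p w z‖ * ‖1 - conj w * z‖) (𝓝[≠] w)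
      (𝓝 (‖deriv p w‖ * ‖1 - conj w * w‖)) :=
    hsl.mul ((hid.const_mul _).const_sub _).norm
  have h2 : Tendsto (fun z => ‖p z + conj (p w)‖) (𝓝[≠] w) (𝓝 (‖p w + conj (p w)‖)) :=
    (hcont.add_const _).norm
  have hle := le_of_tendsto_of_tendsto h1 h2 (by
    filter_upwards [self_mem_nhdsWithin, nhdsWithin_le_nhds (isOpen_disk.mem_nhds hw)] with z hzw hz
    have h := hp.schwarz_pick hz hw
    have hpos : 0 < ‖z - w‖ := norm_pos_iff.2 (sub_ne_zero.2 hzw)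
    rw [slope_def_field, norm_div, div_mul_eq_mul_div, div_le_iff₀ hpos]
    exact h)
  have e1 : ‖1 - conj w * w‖ = 1 - ‖w‖ ^ 2 := by
    rw [← Complex.normSq_eq_conj_mul_self, Complex.normSq_eq_norm_sq, ← Complex.ofReal_one,
      ← Complex.ofReal_sub, Complex.norm_real,
      Real.norm_of_nonneg (one_sub_norm_sq_pos (mem_disk.1 hw)).le]
  have e2 : ‖p w + conj (p w)‖ = 2 * (p w).re := by
    rw [Complex.add_conj, Complex.norm_real, Real.norm_of_nonneg (by linarith [hp.re_nonneg w hw])]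
  rwa [e1, e2] at hle

/-! ### Angular limits and the Cayley map -/

theorem tendsto_angular_iff {α : Type*} {f : ℂ → α} {σ : ℂ} {l : Filter α} :
    Tendsto f (angular σ) l ↔ ∀ M : ℝ, Tendsto f (𝓝[stolz σ M] σ) l :=
  tendsto_iSup

theorem angular_le_nhds (σ : ℂ) : angular σ ≤ 𝓝 σ :=
  iSup_le fun _ => nhdsWithin_le_nhds

theorem tendsto_id_angular (σ : ℂ) : Tendsto (fun z : ℂ => z) (angular σ) (𝓝 σ) :=
  angular_le_nhds σ

theorem eventually_angular_mem_disk (σ : ℂ) : ∀ᶠ z in angular σ, z ∈ disk :=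
  eventually_iSup.2 fun _ => eventually_mem_nhdsWithin.mono fun _ hz => mem_disk.2 hz.1

theorem ne_of_mem_disk {σ z : ℂ} (hσ : ‖σ‖ = 1) (hz : z ∈ disk) : σ - z ≠ 0 := by
  rintro h
  rw [sub_eq_zero] at h
  rw [← h, mem_disk] at hz
  exact hz.ne hσ

/-- The radius to `σ` lies in the Stolz region of aperture `2`. Uniqueness of angular limits rests
on this. -/
theorem angular_neBot {σ : ℂ} (hσ : ‖σ‖ = 1) : (angular σ).NeBot := by
  have h : Tendsto (fun r : ℝ => (r : ℂ) * σ) (𝓝[<] 1) (𝓝[stolz σ 2] σ) := by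
    refine tendsto_nhdsWithin_iff.2 ⟨?_, ?_⟩
    · have : Tendsto (fun r : ℝ => (r : ℂ) * σ) (𝓝 1) (𝓝 (((1 : ℝ) : ℂ) * σ)) :=
        Continuous.tendsto (by fun_prop) _
      simp only [Complex.ofReal_one, one_mul] at this
      exact this.mono_left nhdsWithin_le_nhds
    · filter_upwards [Ioo_mem_nhdsLT (show (0 : ℝ) < 1 by norm_num)] with r hr
      have h1 : ‖(r : ℂ) * σ‖ = r := by
        rw [norm_mul, hσ, mul_one, Complex.norm_real, Real.norm_of_nonneg hr.1.le]
      have h2 : ‖σ - (r : ℂ) * σ‖ = 1 - r := by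
        rw [show σ - (r : ℂ) * σ = ((1 - r : ℝ) : ℂ) * σ by push_cast; ring, norm_mul, hσ, mul_one,
          Complex.norm_real, Real.norm_of_nonneg (by linarith [hr.2])]
      refine ⟨by rw [h1]; exact hr.2, ?_⟩
      rw [h1, h2]
      linarith [hr.2]
  have h3 : (𝓝[stolz σ 2] σ).NeBot := h.neBot
  exact h3.mono (le_iSup (fun M : ℝ => 𝓝[stolz σ M] σ) 2)

theorem conj_mul_self_of_norm_eq_one {σ : ℂ} (hσ : ‖σ‖ = 1) : conj σ * σ = 1 := by
  rw [← Complex.normSq_eq_conj_mul_self, Complex.normSq_eq_norm_sq, hσ]; simp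

theorem one_sub_conj_mul_eq {σ : ℂ} (hσ : ‖σ‖ = 1) (z : ℂ) : 1 - conj σ * z = conj σ * (σ - z) := by
  rw [mul_sub, conj_mul_self_of_norm_eq_one hσ]

theorem norm_one_sub_conj_mul {σ : ℂ} (hσ : ‖σ‖ = 1) (z : ℂ) : ‖1 - conj σ * z‖ = ‖σ - z‖ := by
  rw [one_sub_conj_mul_eq hσ, norm_mul, Complex.norm_conj, hσ, one_mul]

/-- The Cayley map of the disk onto the right half-plane with pole at `σ`. -/
noncomputable def cayley (σ z : ℂ) : ℂ := (σ + z) / (σ - z)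

theorem re_cayley {σ : ℂ} (hσ : ‖σ‖ = 1) (z : ℂ) :
    (cayley σ z).re = (1 - ‖z‖ ^ 2) / ‖σ - z‖ ^ 2 := by
  have h : ‖σ‖ ^ 2 = 1 := by rw [hσ]; norm_num
  rw [cayley, Complex.div_re, ← add_div, Complex.normSq_eq_norm_sq, ← h]
  congr 1
  simp only [Complex.sq_norm, Complex.normSq_apply, Complex.add_re, Complex.sub_re,
    Complex.add_im, Complex.sub_im]
  ring

theorem re_cayley_pos {σ z : ℂ} (hσ : ‖σ‖ = 1) (hz : z ∈ disk) : 0 < (cayley σ z).re := by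
  rw [re_cayley hσ]
  exact div_pos (one_sub_norm_sq_pos (mem_disk.1 hz))
    (pow_pos (norm_pos_iff.2 (ne_of_mem_disk hσ hz)) 2)

theorem differentiableOn_cayley {σ : ℂ} (hσ : ‖σ‖ = 1) : DifferentiableOn ℂ (cayley σ) disk :=
  DifferentiableOn.div (by fun_prop) (by fun_prop) fun _ hz => ne_of_mem_disk hσ hz

theorem isHerglotz_cayley {σ : ℂ} (hσ : ‖σ‖ = 1) : IsHerglotz (cayley σ) :=
  ⟨differentiableOn_cayley hσ, fun _ hz => (re_cayley_pos hσ hz).le⟩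

theorem IsHerglotz.add {p q : ℂ → ℂ} (hp : IsHerglotz p) (hq : IsHerglotz q) :
    IsHerglotz (fun z => p z + q z) :=
  ⟨hp.holo.add hq.holo, fun z hz => by
    rw [Complex.add_re]; exact add_nonneg (hp.re_nonneg z hz) (hq.re_nonneg z hz)⟩

theorem IsHerglotz.ofReal_mul {p : ℂ → ℂ} (hp : IsHerglotz p) {a : ℝ} (ha : 0 ≤ a) :
    IsHerglotz (fun z => (a : ℂ) * p z) :=
  ⟨hp.holo.const_mul _, fun z hz => by
    rw [Complex.re_ofReal_mul]; exact mul_nonneg ha (hp.re_nonneg z hz)⟩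

theorem HasStar.add {p q : ℂ → ℂ} {σ a b : ℂ} (hp : HasStar p σ a) (hq : HasStar q σ b) :
    HasStar (fun z => p z + q z) σ (a + b) := by
  refine (Tendsto.add hp hq).congr fun z => ?_
  ring

theorem HasStar.const_mul {p : ℂ → ℂ} {σ a : ℂ} (hp : HasStar p σ a) (c : ℂ) :
    HasStar (fun z => c * p z) σ (c * a) := by
  refine (Tendsto.const_mul c hp).congr fun z => ?_
  ring

theorem hasStar_cayley_self {σ : ℂ} (hσ : ‖σ‖ = 1) : HasStar (cayley σ) σ 2 := by
  have h : Tendsto (fun z => conj σ * (σ + z)) (angular σ) (𝓝 (conj σ * (σ + σ))) :=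
    ((tendsto_id_angular σ).const_add _).const_mul _
  rw [mul_add, conj_mul_self_of_norm_eq_one hσ, one_add_one_eq_two] at h
  refine h.congr' ?_
  filter_upwards [eventually_angular_mem_disk σ] with z hz
  rw [one_sub_conj_mul_eq hσ, cayley, mul_assoc, mul_div_cancel₀ _ (ne_of_mem_disk hσ hz)]

theorem hasStar_zero_of_continuousAt {p : ℂ → ℂ} {σ : ℂ} (hσ : ‖σ‖ = 1)
    (hp : ContinuousAt p σ) : HasStar p σ 0 := by
  have h : Tendsto (fun z => (1 - conj σ * z) * p z) (angular σ) (𝓝 ((1 - conj σ * σ) * p σ)) :=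
    (((tendsto_id_angular σ).const_mul _).const_sub _).mul (hp.tendsto.mono_left (angular_le_nhds σ))
  rwa [conj_mul_self_of_norm_eq_one hσ, sub_self, zero_mul] at h

theorem continuousAt_cayley {σ z : ℂ} (h : z ≠ σ) : ContinuousAt (cayley σ) z :=
  ContinuousAt.div (by fun_prop) (by fun_prop) (sub_ne_zero.2 h.symm)

/-! ### Boundary atoms of Herglotz functions -/

/-- If the Herglotz function `p` is not bounded below by any positive multiple of the Poisson
kernel at `σ`, then `p⋆(σ) = 0`. -/
theorem IsHerglotz.hasStar_zero {p : ℂ → ℂ} (hp : IsHerglotz p) {σ : ℂ} (hσ : ‖σ‖ = 1)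
    (h : ∀ ε : ℝ, 0 < ε → ∃ w ∈ disk, (p w).re ≤ ε * (cayley σ w).re) : HasStar p σ 0 := by
  refine tendsto_angular_iff.2 fun M => ?_
  rw [tendsto_zero_iff_norm_tendsto_zero, Metric.tendsto_nhds]
  intro ε hε
  set M' := max M 1 with hM'
  have hM1 : 0 < M' := lt_of_lt_of_le one_pos (le_max_right _ _)
  -- The constant makes the majorant `B` equal to `ε / 2` at `σ`: Harnack contributes `4`, the Stolz
  -- condition `M'`, and `‖1 - conj w * σ‖ = ‖σ - w‖` cancels the Poisson denominator.
  obtain ⟨w, hw, hpw⟩ := h (ε / (8 * M')) (by positivity)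
  have hsw : 0 < ‖σ - w‖ := norm_pos_iff.2 (ne_of_mem_disk hσ hw)
  set B : ℂ → ℝ := fun z =>
    ‖σ - z‖ * ‖p w‖ + 4 * M' * (ε / (8 * M') / ‖σ - w‖ ^ 2) * ‖1 - conj w * z‖ ^ 2 with hB
  have hBlim : Tendsto B (𝓝[stolz σ M] σ) (𝓝 (B σ)) :=
    (Continuous.tendsto (by fun_prop) σ).mono_left nhdsWithin_le_nhds
  have e1 : ‖1 - conj w * σ‖ = ‖σ - w‖ := by
    rw [← norm_one_sub_conj_mul hσ, ← Complex.norm_conj]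
    simp [mul_comm]
  have hBσ : B σ = ε / 2 := by
    simp only [hB, sub_self, norm_zero, zero_mul, zero_add, e1]
    field_simp
    norm_num
  rw [hBσ] at hBlim
  filter_upwards [hBlim.eventually_lt_const (show ε / 2 < ε by linarith), self_mem_nhdsWithin]
    with z hz hzS
  rw [Real.dist_0_eq_abs, abs_norm]
  refine lt_of_le_of_lt ?_ hz
  have hzd : z ∈ disk := mem_disk.2 hzS.1
  have hH := hp.norm_sub_le hzd hw
  have hz1 := one_sub_norm_sq_pos hzS.1
  have hw1 := one_sub_norm_sq_pos (mem_disk.1 hw)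
  have hst : ‖σ - z‖ ≤ M' * (1 - ‖z‖ ^ 2) := by
    have h1 : M * (1 - ‖z‖) ≤ M' * (1 - ‖z‖) :=
      mul_le_mul_of_nonneg_right (le_max_left _ _) (by linarith [hzS.1])
    have h2 : M' * (1 - ‖z‖) ≤ M' * (1 - ‖z‖ ^ 2) :=
      mul_le_mul_of_nonneg_left (by nlinarith [norm_nonneg z, hzS.1]) hM1.le
    linarith [hzS.2]
  rw [norm_mul, norm_one_sub_conj_mul hσ]
  have hpz : ‖p z‖ ≤ ‖p w‖ + ‖p z - p w‖ := by
    have := norm_add_le (p w) (p z - p w); rwa [add_sub_cancel] at this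
  have hdiff : ‖p z - p w‖ * (1 - ‖z‖ ^ 2)
      ≤ 4 * (ε / (8 * M') / ‖σ - w‖ ^ 2) * ‖1 - conj w * z‖ ^ 2 := by
    rw [re_cayley hσ] at hpw
    refine le_of_mul_le_mul_right ?_ hw1
    calc ‖p z - p w‖ * (1 - ‖z‖ ^ 2) * (1 - ‖w‖ ^ 2)
        = ‖p z - p w‖ * ((1 - ‖z‖ ^ 2) * (1 - ‖w‖ ^ 2)) := by ring
      _ ≤ 4 * (p w).re * ‖1 - conj w * z‖ ^ 2 := hH
      _ ≤ 4 * (ε / (8 * M') * ((1 - ‖w‖ ^ 2) / ‖σ - w‖ ^ 2)) * ‖1 - conj w * z‖ ^ 2 := by gcongr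
      _ = _ := by ring
  calc ‖σ - z‖ * ‖p z‖ ≤ ‖σ - z‖ * (‖p w‖ + ‖p z - p w‖) := by gcongr
    _ = ‖σ - z‖ * ‖p w‖ + ‖σ - z‖ * ‖p z - p w‖ := by ring
    _ ≤ ‖σ - z‖ * ‖p w‖ + M' * (1 - ‖z‖ ^ 2) * ‖p z - p w‖ := by gcongr
    _ = ‖σ - z‖ * ‖p w‖ + M' * (‖p z - p w‖ * (1 - ‖z‖ ^ 2)) := by ring
    _ ≤ ‖σ - z‖ * ‖p w‖
        + M' * (4 * (ε / (8 * M') / ‖σ - w‖ ^ 2) * ‖1 - conj w * z‖ ^ 2) := by gcongr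
    _ = B z := by simp only [hB]; ring

/-- Existence of `p⋆(σ)`, together with the extraction of the corresponding atom. -/
theorem IsHerglotz.exists_star {p : ℂ → ℂ} (hp : IsHerglotz p) {σ : ℂ} (hσ : ‖σ‖ = 1) :
    ∃ m : ℝ, 0 ≤ m ∧ IsHerglotz (fun z => p z - m * cayley σ z) ∧ HasStar p σ (2 * m) := by
  -- The infimum `m` of these ratios is the mass at `σ`: subtracting `m * cayley σ` keeps the real
  -- part non-negative, and by minimality no positive multiple of the Poisson kernel remains below
  -- it.
  set S : Set ℝ := (fun z => (p z).re / (cayley σ z).re) '' disk with hS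
  have hSne : S.Nonempty := ⟨_, 0, by simp, rfl⟩
  have hS0 : ∀ x ∈ S, 0 ≤ x := by
    rintro _ ⟨z, hz, rfl⟩
    exact div_nonneg (hp.re_nonneg z hz) (re_cayley_pos hσ hz).le
  have hbdd : BddBelow S := ⟨0, hS0⟩
  set m := sInf S with hm
  have hq : IsHerglotz (fun z => p z - m * cayley σ z) := by
    refine ⟨hp.holo.sub ((differentiableOn_cayley hσ).const_mul _), fun z hz => ?_⟩
    have h1 : m ≤ (p z).re / (cayley σ z).re := csInf_le hbdd ⟨z, hz, rfl⟩
    rw [le_div_iff₀ (re_cayley_pos hσ hz)] at h1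
    rw [Complex.sub_re, Complex.re_ofReal_mul]
    linarith
  refine ⟨m, le_csInf hSne hS0, hq, ?_⟩
  have h0 : HasStar (fun z => p z - m * cayley σ z) σ 0 := by
    refine hq.hasStar_zero hσ fun ε hε => ?_
    obtain ⟨_, ⟨w, hw, rfl⟩, hlt⟩ := exists_lt_of_csInf_lt hSne (show m < m + ε by linarith)
    refine ⟨w, hw, ?_⟩
    rw [div_lt_iff₀ (re_cayley_pos hσ hw)] at hlt
    rw [Complex.sub_re, Complex.re_ofReal_mul]
    linarith
  have h1 := h0.add ((hasStar_cayley_self hσ).const_mul m)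
  simp only [sub_add_cancel, zero_add] at h1
  rwa [mul_comm]

/-! ### Linear equations, difference quotients and trajectories -/

/-- A scalar linear differential equation is solved by the exponential of the integral of its
coefficient. -/
theorem eq_mul_exp_integral {u h : ℝ → ℂ} {T : ℝ} (hT : 0 ≤ T)
    (hu : ∀ t ∈ Set.Icc 0 T, HasDerivWithinAt u (h t * u t) (Set.Icc 0 T) t)
    (hh : ContinuousOn h (Set.Icc 0 T)) :
    ∀ t ∈ Set.Icc 0 T, u t = u 0 * Complex.exp (∫ s in (0 : ℝ)..t, h s) := by
  -- Extending `h` by its endpoint values makes the integral differentiable at the endpoints too.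
  set k : ℝ → ℂ := Set.IccExtend hT (Set.domRestrict (Set.Icc 0 T) h) with hk
  have hkc : Continuous k := (continuousOn_iff_continuous_domRestrict.1 hh).Icc_extend'
  have hkh : ∀ t ∈ Set.Icc 0 T, k t = h t := fun t ht => by
    rw [hk, Set.IccExtend_of_mem _ _ ht]; rfl
  have hI : ∀ t, HasDerivAt (fun t => ∫ s in (0 : ℝ)..t, k s) (k t) t := fun t =>
    intervalIntegral.integral_hasDerivAt_right (hkc.intervalIntegrable _ _)
      (hkc.stronglyMeasurableAtFilter _ _) hkc.continuousAt
  set v : ℝ → ℂ := fun t => u t * Complex.exp (-∫ s in (0 : ℝ)..t, k s) with hv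
  have hvd : ∀ t ∈ Set.Icc 0 T, HasDerivWithinAt v 0 (Set.Icc 0 T) t := by
    intro t ht
    have h1 := (hu t ht).mul (((hI t).neg.cexp).hasDerivWithinAt (s := Set.Icc 0 T))
    refine h1.congr_deriv ?_
    rw [hkh t ht]
    ring
  have hconst := constant_of_has_deriv_right_zero (f := v)
    (fun t ht => (hvd t ht).continuousWithinAt)
    (fun t ht => by
      have := hvd t (Set.Ico_subset_Icc_self ht)
      exact this.mono_of_mem_nhdsWithin (Icc_mem_nhdsGE_of_mem ht))
  intro t ht
  have h0 : v 0 = u 0 := by simp [hv]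
  have h1 := hconst t ht
  rw [h0] at h1
  have h2 : ∫ s in (0 : ℝ)..t, h s = ∫ s in (0 : ℝ)..t, k s := by
    refine intervalIntegral.integral_congr fun s hs => ?_
    rw [Set.uIcc_of_le ht.1] at hs
    exact (hkh s ⟨hs.1, hs.2.trans ht.2⟩).symm
  rw [h2, ← h1, hv]
  simp only
  rw [mul_assoc, ← Complex.exp_add, neg_add_cancel, Complex.exp_zero, mul_one]

/-- A continuous function which cannot reach the level `B` for a first time stays below it. -/
theorem lt_of_forall_le_imp_lt {f : ℝ → ℝ} {T B : ℝ} (hf : ContinuousOn f (Set.Icc 0 T))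
    (h0 : f 0 < B) (h : ∀ s ∈ Set.Icc 0 T, (∀ r ∈ Set.Icc 0 s, f r ≤ B) → f s < B) :
    ∀ s ∈ Set.Icc 0 T, f s < B := by
  by_contra hcon
  push Not at hcon
  obtain ⟨s₀, hs₀, hfs₀⟩ := hcon
  have hcomp : IsCompact (Set.Icc 0 T ∩ f ⁻¹' Set.Ici B) :=
    isCompact_Icc.of_isClosed_subset (hf.preimage_isClosed_of_isClosed isClosed_Icc isClosed_Ici)
      Set.inter_subset_left
  obtain ⟨s, ⟨hs, hfs⟩, hmin⟩ := hcomp.exists_isLeast ⟨s₀, hs₀, hfs₀⟩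
  have hs0 : 0 ≠ s := by
    rintro rfl
    exact absurd h0 (not_lt.2 hfs)
  have hlt : ∀ r ∈ Set.Ico 0 s, f r ≤ B := fun r hr => by
    by_contra hc
    exact absurd (hmin ⟨⟨hr.1, hr.2.le.trans hs.2⟩, (not_le.1 hc).le⟩) (not_le.2 hr.2)
  refine absurd (h s hs fun r hr => ?_) (not_lt.2 hfs)
  have hcl := closure_Ico hs0
  refine le_on_closure hlt ?_ continuousOn_const (hcl.symm ▸ hr)
  rw [hcl]
  exact hf.mono (Set.Icc_subset_Icc_right hs.2)

theorem analyticAt_of_differentiableOn_disk {G : ℂ → ℂ} (hG : DifferentiableOn ℂ G disk) {z : ℂ}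
    (hz : z ∈ disk) : AnalyticAt ℂ G z :=
  hG.analyticAt (isOpen_disk.mem_nhds hz)

/-- The difference quotient of a holomorphic function is jointly continuous. -/
theorem continuousOn_uncurry_dslope {G : ℂ → ℂ} (hG : DifferentiableOn ℂ G disk) :
    ContinuousOn (fun x : ℂ × ℂ => dslope G x.1 x.2) (disk ×ˢ disk) := by
  rintro ⟨b, a⟩ ⟨hb, ha⟩
  refine ContinuousAt.continuousWithinAt ?_
  have hGa := (hG.differentiableAt (isOpen_disk.mem_nhds ha)).continuousAt
  have hGb := (hG.differentiableAt (isOpen_disk.mem_nhds hb)).continuousAt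
  by_cases hab : a = b
  · subst hab
    have han := analyticAt_of_differentiableOn_disk hG ha
    rw [ContinuousAt, dslope_same, Metric.tendsto_nhds]
    intro ε hε
    -- Near the diagonal, strict differentiability controls the quotient at distinct points, and
    -- continuity of `deriv G` controls it on the diagonal.
    have h1 := han.hasStrictDerivAt.hasStrictFDerivAt.isLittleO.def (half_pos hε)
    have h2 : ∀ᶠ x : ℂ × ℂ in 𝓝 (a, a), dist (deriv G x.1) (deriv G a) < ε := by
      have : ContinuousAt (fun x : ℂ × ℂ => deriv G x.1) (a, a) :=
        ContinuousAt.comp (f := Prod.fst) (x := (a, a)) han.deriv.continuousAt continuousAt_fst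
      exact Metric.tendsto_nhds.1 this.tendsto ε hε
    filter_upwards [h1, h2] with x hx1 hx2
    by_cases hx : x.2 = x.1
    · rw [hx, dslope_same]; exact hx2
    · have hpos : 0 < ‖x.1 - x.2‖ := norm_pos_iff.2 (sub_ne_zero.2 (Ne.symm hx))
      rw [dslope_of_ne _ hx, slope_comm, slope_def_field, dist_eq_norm]
      have e : (G x.1 - G x.2) / (x.1 - x.2) - deriv G a
          = (G x.1 - G x.2 - (x.1 - x.2) • deriv G a) / (x.1 - x.2) := by
        rw [sub_div _ (_ • _), smul_eq_mul, mul_div_cancel_left₀ _ (sub_ne_zero.2 (Ne.symm hx))]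
      rw [ContinuousLinearMap.toSpanSingleton_apply] at hx1
      rw [e, norm_div, div_lt_iff₀ hpos]
      nlinarith
  · have hne : ∀ᶠ x : ℂ × ℂ in 𝓝 (b, a), x.2 ≠ x.1 :=
      (isOpen_ne_fun continuous_snd continuous_fst).mem_nhds hab
    have hc : ContinuousAt (fun x : ℂ × ℂ => (G x.2 - G x.1) / (x.2 - x.1)) (b, a) := by
      refine ContinuousAt.div (ContinuousAt.sub ?_ ?_) (by fun_prop) (sub_ne_zero.2 hab)
      · exact ContinuousAt.comp (f := Prod.snd) (x := (b, a)) hGa continuousAt_snd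
      · exact ContinuousAt.comp (f := Prod.fst) (x := (b, a)) hGb continuousAt_fst
    refine hc.congr ?_
    filter_upwards [hne] with x hx
    rw [dslope_of_ne _ hx, slope_def_field]

/-- `γ` is a trajectory in the disk of the vector field `G` over the time interval `[0, T]`. -/
def IsTrajectory (G : ℂ → ℂ) (T : ℝ) (γ : ℝ → ℂ) : Prop :=
  ∀ t ∈ Set.Icc 0 T, γ t ∈ disk ∧ HasDerivWithinAt γ (G (γ t)) (Set.Icc 0 T) t

namespace IsTrajectory

variable {G : ℂ → ℂ} {T : ℝ} {γ δ : ℝ → ℂ}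

theorem continuousOn (h : IsTrajectory G T γ) : ContinuousOn γ (Set.Icc 0 T) := fun t ht =>
  (h t ht).2.continuousWithinAt

theorem mapsTo (h : IsTrajectory G T γ) : Set.MapsTo γ (Set.Icc 0 T) disk := fun t ht => (h t ht).1

theorem mono (h : IsTrajectory G T γ) {S : ℝ} (hS : S ≤ T) : IsTrajectory G S γ := fun t ht =>
  have hs := Set.Icc_subset_Icc_right hS
  ⟨(h t (hs ht)).1, (h t (hs ht)).2.mono hs⟩

theorem congr (h : IsTrajectory G T γ) (he : Set.EqOn δ γ (Set.Icc 0 T)) :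
    IsTrajectory G T δ := fun t ht => by
  rw [he ht]
  exact ⟨(h t ht).1, (h t ht).2.congr he (he ht)⟩

theorem continuousOn_dslope (hG : DifferentiableOn ℂ G disk) (hγ : IsTrajectory G T γ)
    (hδ : IsTrajectory G T δ) : ContinuousOn (fun s => dslope G (δ s) (γ s)) (Set.Icc 0 T) :=
  ContinuousOn.comp (g := fun x : ℂ × ℂ => dslope G x.1 x.2) (f := fun s => (δ s, γ s))
    (continuousOn_uncurry_dslope hG) (hδ.continuousOn.prodMk hγ.continuousOn)
    fun _ ht => Set.mk_mem_prod (hδ.mapsTo ht) (hγ.mapsTo ht)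

/-- The difference of two trajectories solves a linear equation whose coefficient is the difference
quotient of `G`. Uniqueness, continuity and complex differentiability in the initial value all
follow from this formula. -/
theorem sub_eq (hG : DifferentiableOn ℂ G disk) (hγ : IsTrajectory G T γ)
    (hδ : IsTrajectory G T δ) {t : ℝ} (ht : t ∈ Set.Icc 0 T) :
    γ t - δ t = (γ 0 - δ 0) * Complex.exp (∫ s in (0 : ℝ)..t, dslope G (δ s) (γ s)) := by
  refine eq_mul_exp_integral (u := fun t => γ t - δ t) (ht.1.trans ht.2) (fun s hs => ?_)
    (hγ.continuousOn_dslope hG hδ) t ht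
  refine ((hγ s hs).2.sub (hδ s hs).2).congr_deriv ?_
  have := sub_smul_dslope G (δ s) (γ s)
  rw [smul_eq_mul, mul_comm] at this
  exact this.symm

theorem eqOn (hG : DifferentiableOn ℂ G disk) (hγ : IsTrajectory G T γ)
    (hδ : IsTrajectory G T δ) (h0 : γ 0 = δ 0) : Set.EqOn γ δ (Set.Icc 0 T) := fun t ht => by
  have := hγ.sub_eq hG hδ ht
  rwa [h0, sub_self, zero_mul, sub_eq_zero] at this

end IsTrajectory

/-! ### Flows of hyperbolically contracting vector fields -/

/-- Infinitesimal form of the contraction of the hyperbolic metric by the flow of `G`. -/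
structure IsHyperbolicallyContracting (G : ℂ → ℂ) : Prop where
  holo : DifferentiableOn ℂ G disk
  re_nonpos : ∀ z ∈ disk, (((1 - ‖z‖ ^ 2 : ℝ) : ℂ) * deriv G z + 2 * conj z * G z).re ≤ 0

theorem hasDerivWithinAt_one_sub_norm_sq {γ : ℝ → ℂ} {γ' : ℂ} {s : Set ℝ} {t : ℝ}
    (h : HasDerivWithinAt γ γ' s t) :
    HasDerivWithinAt (fun t => 1 - ‖γ t‖ ^ 2) (-(2 * (conj (γ t) * γ').re)) s t := by
  have := h.norm_sq.const_sub 1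
  rwa [Complex.inner, mul_comm γ'] at this

/-- The hyperbolic speed decreases along trajectories. -/
theorem IsTrajectory.norm_le {G : ℂ → ℂ} {T : ℝ} {γ : ℝ → ℂ} (hγ : IsTrajectory G T γ)
    (hG : IsHyperbolicallyContracting G) {t : ℝ} (ht : t ∈ Set.Icc 0 T) :
    ‖G (γ t)‖ ≤ ‖G (γ 0)‖ / (1 - ‖γ 0‖ ^ 2) * (1 - ‖γ t‖ ^ 2) := by
  have hpos : ∀ s ∈ Set.Icc 0 T, 0 < 1 - ‖γ s‖ ^ 2 := fun s hs =>
    one_sub_norm_sq_pos (mem_disk.1 (hγ.mapsTo hs))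
  -- The derivative of the squared hyperbolic speed is a non-negative multiple of the expression in
  -- `re_nonpos`.
  have hder : ∀ s ∈ Set.Icc 0 T, HasDerivWithinAt
      (fun s => ‖G (γ s)‖ ^ 2 / (1 - ‖γ s‖ ^ 2) ^ 2)
      (2 * ‖G (γ s)‖ ^ 2 / (1 - ‖γ s‖ ^ 2) ^ 3 *
        (((1 - ‖γ s‖ ^ 2 : ℝ) : ℂ) * deriv G (γ s) + 2 * conj (γ s) * G (γ s)).re)
      (Set.Icc 0 T) s := by
    intro s hs
    have hGs : HasDerivAt G (deriv G (γ s)) (γ s) :=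
      (hG.holo.differentiableAt (isOpen_disk.mem_nhds (hγ.mapsTo hs))).hasDerivAt
    have h1 : HasDerivWithinAt (fun s => G (γ s)) (deriv G (γ s) * G (γ s)) (Set.Icc 0 T) s :=
      hGs.comp_hasDerivWithinAt s (hγ s hs).2
    have h2 := h1.norm_sq.div ((hasDerivWithinAt_one_sub_norm_sq (hγ s hs).2).pow 2)
      (pow_ne_zero 2 (hpos s hs).ne')
    refine h2.congr_deriv ?_
    have e : inner ℝ (G (γ s)) (deriv G (γ s) * G (γ s)) = ‖G (γ s)‖ ^ 2 * (deriv G (γ s)).re := by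
      rw [Complex.inner, mul_assoc, Complex.mul_conj, Complex.normSq_eq_norm_sq, mul_comm,
        Complex.re_ofReal_mul]
    have e2 : (2 * conj (γ s) * G (γ s)).re = 2 * (conj (γ s) * G (γ s)).re := by
      rw [mul_assoc]; simp
    have hne := (hpos s hs).ne'
    rw [e, Complex.add_re, Complex.re_ofReal_mul, e2]
    simp only [Pi.pow_apply]
    generalize (conj (γ s) * G (γ s)).re = c
    generalize (deriv G (γ s)).re = d
    generalize 1 - ‖γ s‖ ^ 2 = D at hne
    push_cast
    field_simp
    ring
  have hanti : AntitoneOn (fun s => ‖G (γ s)‖ ^ 2 / (1 - ‖γ s‖ ^ 2) ^ 2) (Set.Icc 0 T) := by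
    refine antitoneOn_of_hasDerivWithinAt_nonpos (convex_Icc _ _)
      (fun s hs => (hder s hs).continuousWithinAt)
      (fun s hs => (hder s (interior_subset hs)).mono interior_subset) fun s hs => ?_
    have hs' := interior_subset hs
    exact mul_nonpos_of_nonneg_of_nonpos
      (div_nonneg (by positivity) (pow_nonneg (hpos s hs').le 3))
      (hG.re_nonpos _ (hγ.mapsTo hs'))
  have h0 : (0 : ℝ) ∈ Set.Icc 0 T := ⟨le_rfl, ht.1.trans ht.2⟩
  have h := hanti h0 ht ht.1
  simp only [← div_pow] at h
  have h' := le_of_sq_le_sq h (div_nonneg (norm_nonneg _) (hpos 0 h0).le)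
  rwa [div_le_iff₀ (hpos t ht)] at h'

/-- Hyperbolic speed never exceeds its initial value `V`, so `1 - ‖γ‖²` decays at most like `exp (-2
V t)`: the circle is not reached in finite time. -/
theorem IsTrajectory.one_sub_norm_sq_ge {G : ℂ → ℂ} {T : ℝ} {γ : ℝ → ℂ} (hγ : IsTrajectory G T γ)
    (hG : IsHyperbolicallyContracting G) {t : ℝ} (ht : t ∈ Set.Icc 0 T) :
    (1 - ‖γ 0‖ ^ 2) * Real.exp (-(2 * (‖G (γ 0)‖ / (1 - ‖γ 0‖ ^ 2)) * t)) ≤ 1 - ‖γ t‖ ^ 2 := by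
  set V := ‖G (γ 0)‖ / (1 - ‖γ 0‖ ^ 2) with hV
  have hder : ∀ s ∈ Set.Icc 0 T, HasDerivWithinAt
      (fun s => (1 - ‖γ s‖ ^ 2) * Real.exp (2 * V * s))
      (-(2 * (conj (γ s) * G (γ s)).re) * Real.exp (2 * V * s)
        + (1 - ‖γ s‖ ^ 2) * (Real.exp (2 * V * s) * (2 * V))) (Set.Icc 0 T) s := by
    intro s hs
    have h1 : HasDerivAt (fun s : ℝ => Real.exp (2 * V * s)) (Real.exp (2 * V * s) * (2 * V)) s := by
      simpa using ((hasDerivAt_id s).const_mul (2 * V)).exp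
    exact (hasDerivWithinAt_one_sub_norm_sq (hγ s hs).2).mul h1.hasDerivWithinAt
  have hmono : MonotoneOn (fun s => (1 - ‖γ s‖ ^ 2) * Real.exp (2 * V * s)) (Set.Icc 0 T) := by
    refine monotoneOn_of_hasDerivWithinAt_nonneg (convex_Icc _ _)
      (fun s hs => (hder s hs).continuousWithinAt)
      (fun s hs => (hder s (interior_subset hs)).mono interior_subset) fun s hs => ?_
    have hs' := interior_subset hs
    have h1 := hγ.norm_le hG hs'
    rw [← hV] at h1
    have h2 : (conj (γ s) * G (γ s)).re ≤ ‖G (γ s)‖ := by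
      refine (Complex.re_le_norm _).trans ?_
      rw [norm_mul, Complex.norm_conj]
      exact mul_le_of_le_one_left (norm_nonneg _) (mem_disk.1 (hγ.mapsTo hs')).le
    have h3 : 0 ≤ Real.exp (2 * V * s) * (2 * (V * (1 - ‖γ s‖ ^ 2) - (conj (γ s) * G (γ s)).re)) :=
      mul_nonneg (Real.exp_pos _).le (by linarith)
    linarith
  have h := hmono ⟨le_rfl, ht.1.trans ht.2⟩ ht ht.1
  simp only [mul_zero, Real.exp_zero, mul_one] at h
  rw [Real.exp_neg, ← div_eq_mul_inv, div_le_iff₀ (Real.exp_pos _)]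
  exact h

/-- Trajectories of a hyperbolically contracting vector field starting in a compact set stay in a
compact set for bounded times. -/
theorem IsHyperbolicallyContracting.exists_radius {G : ℂ → ℂ} (hG : IsHyperbolicallyContracting G)
    {r : ℝ} (hr : r < 1) (T : ℝ) : ∃ R, 0 < R ∧ R < 1 ∧ ∀ (S : ℝ) (γ : ℝ → ℂ), S ≤ T → ‖γ 0‖ ≤ r →
      IsTrajectory G S γ → ∀ t ∈ Set.Icc 0 S, ‖γ t‖ < R := by
  have hsub : closedBall (0 : ℂ) r ⊆ disk := closedBall_subset_ball hr
  obtain ⟨C, hC⟩ := (isCompact_closedBall (0 : ℂ) r).exists_bound_of_continuousOn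
    (hG.holo.continuousOn.mono hsub)
  set C' := max C 0
  set ρ := max r 0
  have hρ0 : 0 ≤ ρ := le_max_right _ _
  have hρ1 : ρ < 1 := max_lt hr one_pos
  set W := C' / (1 - ρ ^ 2) with hW
  have hρ2 : 0 < 1 - ρ ^ 2 := by nlinarith
  have hW0 : 0 ≤ W := div_nonneg (le_max_right _ _) hρ2.le
  set η := (1 - ρ ^ 2) * Real.exp (-(2 * W * max T 0)) with hη
  have hη0 : 0 < η := mul_pos hρ2 (Real.exp_pos _)
  have hη1 : η ≤ 1 := by
    have : Real.exp (-(2 * W * max T 0)) ≤ 1 :=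
      Real.exp_le_one_iff.2 (by have := mul_nonneg hW0 (le_max_right T 0); nlinarith)
    calc η ≤ 1 * 1 := by
          rw [hη]; gcongr
          nlinarith
      _ = 1 := one_mul 1
  -- `η` bounds `1 - ‖γ t‖ ^ 2` from below; halving it makes `‖γ t‖ < R` strict, as the continuation
  -- argument requires.
  refine ⟨Real.sqrt (1 - η / 2), Real.sqrt_pos.2 (by linarith), ?_, ?_⟩
  · rw [Real.sqrt_lt' one_pos]; linarith
  · intro S γ hS h0 hγ t ht
    have h1 := hγ.one_sub_norm_sq_ge hG ht
    have hGC : ‖G (γ 0)‖ ≤ C' := (hC _ (mem_closedBall_zero_iff.2 h0)).trans (le_max_left _ _)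
    have hn : ‖γ 0‖ ^ 2 ≤ ρ ^ 2 := by
      have : ‖γ 0‖ ≤ ρ := h0.trans (le_max_left _ _)
      gcongr
    have hV : ‖G (γ 0)‖ / (1 - ‖γ 0‖ ^ 2) ≤ W := by
      rw [hW]
      exact div_le_div₀ (le_max_right _ _) hGC hρ2 (by linarith)
    have htT : t ≤ max T 0 := (ht.2.trans hS).trans (le_max_left _ _)
    have hexp : 2 * (‖G (γ 0)‖ / (1 - ‖γ 0‖ ^ 2)) * t ≤ 2 * W * max T 0 :=
      mul_le_mul (by linarith) htT ht.1 (by linarith)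
    have h2 : η ≤ 1 - ‖γ t‖ ^ 2 := by
      refine le_trans ?_ h1
      rw [hη]
      gcongr
      linarith
    rw [Real.lt_sqrt (norm_nonneg _)]
    linarith

/-- A bounded, globally Lipschitz vector field agreeing with `G` on a given compact disk. -/
theorem exists_lipschitz_cutoff {G : ℂ → ℂ} (hG : DifferentiableOn ℂ G disk) {R : ℝ}
    (hR0 : 0 < R) (hR : R < 1) : ∃ F : ℂ → ℂ, (∃ K, LipschitzWith K F) ∧ (∃ C, ∀ z, ‖F z‖ ≤ C) ∧
      ∀ z, ‖z‖ ≤ R → F z = G z := by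
  let χ : ContDiffBump (0 : ℂ) := ⟨R, (1 + R) / 2, hR0, by linarith⟩
  set F : ℂ → ℂ := fun z => χ z • G z with hF
  have hsupp : HasCompactSupport F := χ.hasCompactSupport.smul_right
  have hsm : ContDiff ℝ 1 F := by
    rw [contDiff_iff_contDiffAt]
    intro z
    by_cases hz : z ∈ disk
    · have h1 : ContDiffAt ℝ 1 G z :=
        (analyticAt_of_differentiableOn_disk hG hz).contDiffAt.restrict_scalars ℝ
      exact χ.contDiffAt.smul h1
    · have hz1 : (1 + R) / 2 < ‖z‖ := by
        have := not_lt.1 (mt mem_disk.2 hz); linarith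
      have : F =ᶠ[𝓝 z] fun _ => 0 := by
        filter_upwards [(isOpen_lt continuous_const continuous_norm).mem_nhds hz1] with w hw
        have : χ w = 0 := χ.zero_of_le_dist (by rw [dist_zero_right]; exact le_of_lt hw)
        simp [hF, this]
      exact contDiffAt_const.congr_of_eventuallyEq this
  refine ⟨F, hsm.lipschitzWith_of_hasCompactSupport hsupp one_ne_zero,
    hsm.continuous.bounded_above_of_compact_support hsupp, fun z hz => ?_⟩
  have : χ z = 1 := χ.one_of_mem_closedBall (mem_closedBall_zero_iff.2 hz)
  simp [hF, this]

/-- Picard–Lindelöf solves the equation of a bounded Lipschitz cutoff on all of `[0, T]`. The a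
priori radius `R` keeps the solution where the cutoff equals `G`. -/
theorem IsHyperbolicallyContracting.exists_trajectory {G : ℂ → ℂ}
    (hG : IsHyperbolicallyContracting G) {z : ℂ} (hz : z ∈ disk) {T : ℝ} (hT : 0 ≤ T) :
    ∃ γ : ℝ → ℂ, γ 0 = z ∧ IsTrajectory G T γ := by
  obtain ⟨R, hR0, hR1, hR⟩ := hG.exists_radius (mem_disk.1 hz) T
  have hzR : ‖z‖ < R := by
    -- The a priori bound speaks only of trajectories, so `‖z‖ < R` is read off from one over the
    -- degenerate interval `[0, 0]`.
    have h : IsTrajectory G 0 (fun s => z + s • G z) := by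
      intro t ht
      obtain rfl : t = 0 := le_antisymm ht.2 ht.1
      refine ⟨by simpa using hz, ?_⟩
      have := (((hasDerivAt_id (0 : ℝ)).smul_const (G z)).const_add z).hasDerivWithinAt
        (s := Set.Icc 0 0)
      simpa using this
    have := hR 0 _ hT (by simp) h 0 ⟨le_rfl, le_rfl⟩
    simpa using this
  obtain ⟨F, ⟨K, hK⟩, ⟨C, hC⟩, hFG⟩ := exists_lipschitz_cutoff hG.holo hR0 hR1
  have hC0 : 0 ≤ C := (norm_nonneg _).trans (hC 0)
  have hPL : IsPicardLindelof (fun _ => F) (⟨0, le_rfl, hT⟩ : Set.Icc 0 T) z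
      (C.toNNReal * T.toNNReal) 0 C.toNNReal K := by
    refine IsPicardLindelof.of_time_independent (fun x _ => ?_) hK.lipschitzOnWith ?_
    · rw [Real.coe_toNNReal _ hC0]; exact hC x
    · simp [Real.coe_toNNReal _ hC0, hT]
  obtain ⟨γ, h0, hγ⟩ := hPL.exists_eq_forall_mem_Icc_hasDerivWithinAt₀
  have hcont : ContinuousOn γ (Set.Icc 0 T) := fun t ht => (hγ t ht).continuousWithinAt
  have hbd : ∀ s ∈ Set.Icc 0 T, ‖γ s‖ < R := by
    refine lt_of_forall_le_imp_lt hcont.norm (by rw [h0]; exact hzR) fun s hs hle => ?_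
    refine hR s γ hs.2 (by rw [h0]) (fun r hr => ?_) s ⟨hs.1, le_rfl⟩
    have hsub := Set.Icc_subset_Icc_right (b := (0 : ℝ)) hs.2
    refine ⟨mem_disk.2 ((hle r hr).trans_lt hR1), ?_⟩
    rw [← hFG _ (hle r hr)]
    exact (hγ r (hsub hr)).mono hsub
  refine ⟨γ, h0, fun t ht => ⟨mem_disk.2 ((hbd t ht).trans hR1), ?_⟩⟩
  rw [← hFG _ (hbd t ht).le]
  exact hγ t ht

theorem norm_exp_integral_le {h : ℝ → ℂ} {C t : ℝ} (ht : 0 ≤ t)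
    (hC : ∀ s ∈ Set.Icc 0 t, ‖h s‖ ≤ C) :
    ‖Complex.exp (∫ s in (0 : ℝ)..t, h s)‖ ≤ Real.exp (C * t) := by
  refine (Complex.norm_exp_le_exp_norm _).trans (Real.exp_le_exp.2 ?_)
  have := intervalIntegral.norm_integral_le_of_norm_le_const (a := 0) (b := t) (f := h) (C := C)
    fun s hs => hC s (by rw [Set.uIoc_of_le ht] at hs; exact Set.Ioc_subset_Icc_self hs)
  rwa [sub_zero, abs_of_nonneg ht] at this

theorem IsGeneratorOf.isTrajectory {G : ℂ → ℂ} {φ : ℝ → ℂ → ℂ} (h : IsGeneratorOf G φ) {z : ℂ}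
    (hz : z ∈ disk) (T : ℝ) : IsTrajectory G T (fun t => φ t z) := fun t ht =>
  ⟨h.semigroup.mapsTo t ht.1 hz, (h.flow z hz t ht.1).mono Set.Icc_subset_Ici_self⟩

/-- The time-`t` map of a hyperbolically contracting vector field is holomorphic. -/
theorem IsHyperbolicallyContracting.differentiableOn_flow {G : ℂ → ℂ}
    (hG : IsHyperbolicallyContracting G) {φ : ℝ → ℂ → ℂ} (h0 : ∀ z ∈ disk, φ 0 z = z) {t : ℝ}
    (ht : 0 ≤ t) (hφ : ∀ z ∈ disk, IsTrajectory G t (fun s => φ s z)) :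
    DifferentiableOn ℂ (φ t) disk := by
  intro z hz
  have hz1 := mem_disk.1 hz
  obtain ⟨R, hR0, hR1, hR⟩ := hG.exists_radius (show (1 + ‖z‖) / 2 < 1 by linarith) t
  have hsub : closedBall (0 : ℂ) R ⊆ disk := closedBall_subset_ball hR1
  obtain ⟨C, hC⟩ := ((isCompact_closedBall (0 : ℂ) R).prod
    (isCompact_closedBall (0 : ℂ) R)).exists_bound_of_continuousOn
      ((continuousOn_uncurry_dslope hG.holo).mono (Set.prod_mono hsub hsub))
  have hN : ∀ᶠ w in 𝓝 z, w ∈ disk ∧ ∀ s ∈ Set.Icc 0 t, ‖φ s w‖ ≤ R := by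
    have : ∀ᶠ w in 𝓝 z, ‖w‖ < (1 + ‖z‖) / 2 :=
      (isOpen_lt continuous_norm continuous_const).mem_nhds (show ‖z‖ < (1 + ‖z‖) / 2 by linarith)
    filter_upwards [this] with w hw
    have hwd : w ∈ disk := mem_disk.2 (by linarith)
    exact ⟨hwd, fun s hs => (hR t _ le_rfl (by rw [h0 w hwd]; exact hw.le) (hφ w hwd) s hs).le⟩
  have hzR := hN.self_of_nhds.2
  have hbound : ∀ᶠ w in 𝓝 z, ∀ s ∈ Set.Icc 0 t, ‖dslope G (φ s z) (φ s w)‖ ≤ C := by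
    filter_upwards [hN] with w hw s hs
    exact hC (φ s z, φ s w)
      ⟨mem_closedBall_zero_iff.2 (hzR s hs), mem_closedBall_zero_iff.2 (hw.2 s hs)⟩
  -- Continuity in the initial value comes first: it makes the integrand of the exponential formula
  -- continuous at `z`, and dominated convergence then gives the limit of the slopes.
  have hcont : ∀ s ∈ Set.Icc 0 t, ContinuousAt (φ s) z := by
    intro s hs
    have hb : ∀ᶠ w in 𝓝 z, ‖φ s w - φ s z‖ ≤ ‖w - z‖ * Real.exp (C * s) := by
      filter_upwards [hN, hbound] with w hw hwb
      rw [(hφ w hw.1).sub_eq hG.holo (hφ z hz) hs, h0 w hw.1, h0 z hz, norm_mul]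
      gcongr
      exact norm_exp_integral_le hs.1 fun r hr => hwb r ⟨hr.1, hr.2.trans hs.2⟩
    rw [ContinuousAt, tendsto_iff_norm_sub_tendsto_zero]
    have hlim : Tendsto (fun w => ‖w - z‖ * Real.exp (C * s)) (𝓝 z)
        (𝓝 (‖z - z‖ * Real.exp (C * s))) := Continuous.tendsto (by fun_prop) z
    rw [sub_self, norm_zero, zero_mul] at hlim
    exact squeeze_zero' (Eventually.of_forall fun _ => norm_nonneg _) hb hlim
  have hint : ContinuousAt (fun w => ∫ s in (0 : ℝ)..t, dslope G (φ s z) (φ s w)) z := by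
    refine intervalIntegral.continuousAt_of_dominated_interval (bound := fun _ => C) ?_ ?_
      intervalIntegrable_const ?_
    · filter_upwards [hN] with w hw
      rw [Set.uIoc_of_le ht]
      refine (ContinuousOn.mono ?_ Set.Ioc_subset_Icc_self).aestronglyMeasurable measurableSet_Ioc
      exact (hφ w hw.1).continuousOn_dslope hG.holo (hφ z hz)
    · filter_upwards [hbound] with w hw
      refine Eventually.of_forall fun s hs => hw s ?_
      rw [Set.uIoc_of_le ht] at hs
      exact Set.Ioc_subset_Icc_self hs
    · refine Eventually.of_forall fun s hs => ?_
      rw [Set.uIoc_of_le ht] at hs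
      have hs' := Set.Ioc_subset_Icc_self hs
      have hd := (hφ z hz).mapsTo hs'
      have h1 : ContinuousAt (fun x : ℂ × ℂ => dslope G x.1 x.2) (φ s z, φ s z) :=
        (continuousOn_uncurry_dslope hG.holo).continuousAt
          ((isOpen_disk.prod isOpen_disk).mem_nhds ⟨hd, hd⟩)
      exact ContinuousAt.comp (f := fun w => (φ s z, φ s w)) (x := z) h1
        (continuousAt_const.prodMk (hcont s hs'))
  refine (HasDerivAt.differentiableAt (f' := Complex.exp
    (∫ s in (0 : ℝ)..t, dslope G (φ s z) (φ s z))) ?_).differentiableWithinAt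
  rw [hasDerivAt_iff_tendsto_slope]
  refine (hint.cexp.tendsto.mono_left nhdsWithin_le_nhds).congr' ?_
  filter_upwards [nhdsWithin_le_nhds hN, self_mem_nhdsWithin] with w hw hwz
  rw [slope_def_field, (hφ w hw.1).sub_eq hG.holo (hφ z hz) ⟨ht, le_rfl⟩, h0 w hw.1, h0 z hz,
    mul_div_cancel_left₀ _ (sub_ne_zero.2 hwz)]

/-- A hyperbolically contracting vector field generates a one-parameter semigroup. -/
theorem IsHyperbolicallyContracting.exists_isGeneratorOf {G : ℂ → ℂ}
    (hG : IsHyperbolicallyContracting G) : ∃ φ, IsGeneratorOf G φ := by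
  have hex : ∀ (z : ℂ) (T : ℝ), ∃ γ : ℝ → ℂ, z ∈ disk → 0 ≤ T → γ 0 = z ∧ IsTrajectory G T γ := by
    intro z T
    by_cases h : z ∈ disk ∧ 0 ≤ T
    · obtain ⟨γ, hγ⟩ := hG.exists_trajectory h.1 h.2
      exact ⟨γ, fun _ _ => hγ⟩
    · exact ⟨0, fun h1 h2 => absurd ⟨h1, h2⟩ h⟩
  choose Γ hΓ using hex
  -- A separate trajectory is chosen for every time horizon; uniqueness makes the diagonal choice a
  -- single flow.
  set φ : ℝ → ℂ → ℂ := fun t z => Γ z t t with hφdef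
  have hφ0 : ∀ z ∈ disk, φ 0 z = z := fun z hz => (hΓ z 0 hz le_rfl).1
  have hφT : ∀ z ∈ disk, ∀ T, IsTrajectory G T (fun t => φ t z) := by
    intro z hz T
    rcases lt_or_ge T 0 with hT | hT
    · intro t ht
      linarith [ht.1, ht.2]
    refine (hΓ z T hz hT).2.congr fun t ht => ?_
    refine ((hΓ z t hz ht.1).2).eqOn hG.holo ((hΓ z T hz hT).2.mono ht.2) ?_ ⟨ht.1, le_rfl⟩
    rw [(hΓ z t hz ht.1).1, (hΓ z T hz hT).1]
  have hflow : ∀ z ∈ disk, ∀ t, 0 ≤ t →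
      HasDerivWithinAt (fun s => φ s z) (G (φ t z)) (Set.Ici 0) t := by
    intro z hz t ht
    have h1 := (hφT z hz (t + 1) t ⟨ht, by linarith⟩).2
    refine h1.mono_of_mem_nhdsWithin ?_
    rw [← Set.Ici_inter_Iic]
    exact inter_mem self_mem_nhdsWithin (nhdsWithin_le_nhds (Iic_mem_nhds (by linarith)))
  refine ⟨φ, ⟨?_, ?_, hφ0, ?_, ?_⟩, hG.holo, hflow⟩
  · exact fun t ht => hG.differentiableOn_flow hφ0 ht fun z hz => hφT z hz t
  · exact fun t ht z hz => (hφT z hz t).mapsTo ⟨ht, le_rfl⟩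
  · intro s t hs ht z hz
    have hw : φ t z ∈ disk := (hφT z hz t).mapsTo ⟨ht, le_rfl⟩
    have h1 : IsTrajectory G s (fun r => φ (r + t) z) := by
      intro r hr
      have hr' : 0 ≤ r + t := by linarith [hr.1]
      refine ⟨(hφT z hz (r + t)).mapsTo ⟨hr', le_rfl⟩, ?_⟩
      have h2 := HasDerivWithinAt.scomp r (hflow z hz (r + t) hr')
        (((hasDerivAt_id r).add_const t).hasDerivWithinAt (s := Set.Icc 0 s))
        (fun x hx => by simp only [Set.mem_Ici, id]; linarith [hx.1])
      rw [one_smul] at h2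
      exact h2
    refine h1.eqOn hG.holo (hφT _ hw s) ?_ ⟨hs, le_rfl⟩
    simp only [zero_add]
    rw [hφ0 _ hw]
  · intro z hz
    have h1 := (hflow z hz 0 le_rfl).continuousWithinAt.tendsto
    simp only [hφ0 z hz] at h1
    exact h1.mono_left (nhdsWithin_mono _ Set.Ioi_subset_Ici_self)

/-! ### Spectral values and boundary regular fixed points -/

/-- The spectral quotient is, up to sign, the logarithmic derivative of `φ t z - σ` in `t`, so its
integral controls the angular difference quotient of `φ t`. -/
theorem IsGeneratorOf.sub_eq {G : ℂ → ℂ} {φ : ℝ → ℂ → ℂ} (h : IsGeneratorOf G φ) {σ : ℂ}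
    (hσ : ‖σ‖ = 1) {z : ℂ} (hz : z ∈ disk) {t : ℝ} (ht : 0 ≤ t) :
    φ t z - σ = (z - σ) * Complex.exp (∫ s in (0 : ℝ)..t, -(G (φ s z) / (σ - φ s z))) := by
  have htr := h.isTrajectory hz t
  have h1 := eq_mul_exp_integral (u := fun s => φ s z - σ)
    (h := fun s => -(G (φ s z) / (σ - φ s z))) ht
    (fun s hs => by
      refine ((htr s hs).2.sub_const σ).congr_deriv ?_
      have := ne_of_mem_disk hσ (htr.mapsTo hs)
      field_simp
      ring)
    (by
      refine (ContinuousOn.div ?_ (continuousOn_const.sub htr.continuousOn) fun s hs =>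
        ne_of_mem_disk hσ (htr.mapsTo hs)).neg
      exact h.holo.continuousOn.comp htr.continuousOn htr.mapsTo) t ⟨ht, le_rfl⟩
  simpa only [h.semigroup.zero z hz] using h1

/-- The orbit of `0` over `[0, t]` is compact in the disk, so one constant serves all times `s`. -/
theorem IsGeneratorOf.exists_one_sub_norm_le {G : ℂ → ℂ} {φ : ℝ → ℂ → ℂ} (h : IsGeneratorOf G φ)
    {t : ℝ} (ht : 0 ≤ t) : ∃ K : ℝ, 0 < K ∧
      ∀ s ∈ Set.Icc 0 t, ∀ z ∈ disk, 1 - ‖z‖ ≤ K * (1 - ‖φ s z‖) := by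
  have h0 : (0 : ℂ) ∈ disk := by simp
  have htr := h.isTrajectory h0 t
  obtain ⟨s₀, hs₀, hmax⟩ := isCompact_Icc.exists_isMaxOn ⟨0, le_rfl, ht⟩ htr.continuousOn.norm
  have hρ : 0 < 1 - ‖φ s₀ 0‖ := sub_pos.2 (mem_disk.1 (htr.mapsTo hs₀))
  refine ⟨4 / (1 - ‖φ s₀ 0‖), by positivity, fun s hs z hz => ?_⟩
  have h1 := one_sub_norm_le_of_mapsTo (h.semigroup.holo s hs.1) (h.semigroup.mapsTo s hs.1) hz
  have h2 : ‖φ s 0‖ ≤ ‖φ s₀ 0‖ := hmax hs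
  have h3 : (1 - ‖z‖) * (1 - ‖φ s₀ 0‖) ≤ (1 - ‖z‖) * (1 - ‖φ s 0‖) :=
    mul_le_mul_of_nonneg_left (by linarith) (by linarith [mem_disk.1 hz])
  rw [div_mul_eq_mul_div, le_div_iff₀ hρ]
  linarith

/-- Trajectories starting non-tangentially near a point `σ` at which `G z / (σ - z)` has a finite
angular limit stay, for a bounded time, in a region where this quotient is near its limit. -/
theorem IsGeneratorOf.eventually_norm_sub_le {G : ℂ → ℂ} {φ : ℝ → ℂ → ℂ} (h : IsGeneratorOf G φ)
    {σ : ℂ} (hσ : ‖σ‖ = 1) {l : ℝ} (hl : HasSpectralValue G σ l) {t : ℝ} (ht : 0 ≤ t) {ε : ℝ}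
    (hε : 0 < ε) :
    ∀ᶠ z in angular σ, ∀ s ∈ Set.Icc 0 t, ‖G (φ s z) / (σ - φ s z) - l‖ ≤ ε := by
  obtain ⟨K, hK0, hK⟩ := h.exists_one_sub_norm_le ht
  refine eventually_iSup.2 fun M => ?_
  -- `E` strictly exceeds the possible growth of `‖φ s z - σ‖ / ‖z - σ‖`. It fixes both the enlarged
  -- aperture `E * M * K` and the starting radius `δ / E`.
  set E := Real.exp ((|l| + ε) * t) + 1 with hE
  have hE0 : 0 < E := by positivity
  have hlim := Metric.tendsto_nhds.1 (tendsto_angular_iff.1 hl (E * M * K)) ε hε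
  obtain ⟨δ, hδ, hδS⟩ := Metric.mem_nhdsWithin_iff.1 hlim
  have hnear : ∀ᶠ z in 𝓝[stolz σ M] σ, z ∈ ball σ (δ / E) :=
    nhdsWithin_le_nhds (ball_mem_nhds σ (by positivity))
  filter_upwards [hnear, self_mem_nhdsWithin] with z hzn hzS
  have hz : z ∈ disk := mem_disk.2 hzS.1
  have htr := h.isTrajectory hz t
  have hpos : 0 < ‖z - σ‖ := by
    rw [norm_sub_rev]; exact norm_pos_iff.2 (ne_of_mem_disk hσ hz)
  have hgood : ∀ s ∈ Set.Icc 0 t, ‖φ s z - σ‖ ≤ E * ‖z - σ‖ →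
      ‖G (φ s z) / (σ - φ s z) - l‖ ≤ ε := by
    intro s hs hle
    have h1 : φ s z ∈ ball σ δ := by
      rw [mem_ball, dist_eq_norm] at hzn ⊢
      rw [lt_div_iff₀ hE0] at hzn
      linarith
    have h2 : φ s z ∈ stolz σ (E * M * K) := by
      refine ⟨mem_disk.1 (htr.mapsTo hs), ?_⟩
      have hM : 0 < M := by
        have h3 := (norm_nonneg _).trans_lt hzS.2
        exact pos_of_mul_pos_left h3 (by linarith [hzS.1])
      rw [norm_sub_rev]
      calc ‖φ s z - σ‖ ≤ E * ‖z - σ‖ := hle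
        _ < E * (M * (1 - ‖z‖)) := by
            rw [norm_sub_rev]; exact mul_lt_mul_of_pos_left hzS.2 hE0
        _ ≤ E * (M * (K * (1 - ‖φ s z‖))) := by
            gcongr; exact hK s hs z hz
        _ = E * M * K * (1 - ‖φ s z‖) := by ring
    have h3 := hδS ⟨h1, h2⟩
    rw [Set.mem_ofPred_eq, dist_eq_norm] at h3
    exact h3.le
  have hE1 : 1 < E := by rw [hE]; linarith [Real.exp_pos ((|l| + ε) * t)]
  -- Bootstrap: while the distance is at most `E * ‖z - σ‖`, the quotient is within `ε` of `l`, and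
  -- the exponential formula then makes the bound strict.
  have hstay : ∀ s ∈ Set.Icc 0 t, ‖φ s z - σ‖ < E * ‖z - σ‖ := by
    refine lt_of_forall_le_imp_lt (htr.continuousOn.sub continuousOn_const).norm ?_ ?_
    · rw [h.semigroup.zero z hz]
      exact lt_mul_of_one_lt_left hpos hE1
    · intro s hs hle
      rw [h.sub_eq hσ hz hs.1, norm_mul, mul_comm]
      refine mul_lt_mul_of_pos_right ?_ hpos
      refine (norm_exp_integral_le (C := |l| + ε) hs.1 fun r hr => ?_).trans_lt ?_
      · have h1 := hgood r ⟨hr.1, hr.2.trans hs.2⟩ (hle r hr)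
        rw [norm_neg]
        have h2 := norm_add_le (G (φ r z) / (σ - φ r z) - l) l
        rw [sub_add_cancel, Complex.norm_real, Real.norm_eq_abs] at h2
        linarith
      · have : Real.exp ((|l| + ε) * s) ≤ Real.exp ((|l| + ε) * t) :=
          Real.exp_le_exp.2 (mul_le_mul_of_nonneg_left hs.2 (by positivity))
        linarith
  exact fun s hs => hgood s hs (hstay s hs).le

/-- A point at which the generator has a finite spectral value is a boundary regular fixed point
of the semigroup. -/
theorem IsGeneratorOf.hasBRFPWithDeriv {G : ℂ → ℂ} {φ : ℝ → ℂ → ℂ} (h : IsGeneratorOf G φ)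
    {σ : ℂ} (hσ : ‖σ‖ = 1) {l : ℝ} (hl : HasSpectralValue G σ l) {t : ℝ} (ht : 0 ≤ t) :
    HasBRFPWithDeriv (φ t) σ (Real.exp (-(l * t)) : ℝ) := by
  have hint : Tendsto (fun z => ∫ s in (0 : ℝ)..t, -(G (φ s z) / (σ - φ s z))) (angular σ)
      (𝓝 (-(l * t) : ℝ)) := by
    rw [Metric.tendsto_nhds]
    intro ε hε
    filter_upwards [h.eventually_norm_sub_le hσ hl ht (ε := ε / (t + 1)) (by positivity),
      eventually_angular_mem_disk σ] with z hz hzd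
    have htr := h.isTrajectory hzd t
    have hc : ContinuousOn (fun s => -(G (φ s z) / (σ - φ s z))) (Set.Icc 0 t) := by
      refine (ContinuousOn.div ?_ (continuousOn_const.sub htr.continuousOn) fun s hs =>
        ne_of_mem_disk hσ (htr.mapsTo hs)).neg
      exact h.holo.continuousOn.comp htr.continuousOn htr.mapsTo
    have e : (∫ s in (0 : ℝ)..t, -(G (φ s z) / (σ - φ s z))) - (-(l * t) : ℝ)
        = ∫ s in (0 : ℝ)..t, (-(G (φ s z) / (σ - φ s z)) - (-l : ℂ)) := by
      rw [intervalIntegral.integral_sub (ContinuousOn.intervalIntegrable_of_Icc ht hc)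
        intervalIntegrable_const, intervalIntegral.integral_const]
      simp [mul_comm]
    rw [dist_eq_norm, e]
    have h1 := intervalIntegral.norm_integral_le_of_norm_le_const (a := 0) (b := t)
      (f := fun s => -(G (φ s z) / (σ - φ s z)) - (-l : ℂ)) (C := ε / (t + 1)) fun s hs => by
        rw [Set.uIoc_of_le ht] at hs
        rw [← norm_neg]
        simpa [sub_eq_add_neg, add_comm] using hz s (Set.Ioc_subset_Icc_self hs)
    rw [sub_zero, abs_of_nonneg ht] at h1
    refine h1.trans_lt ?_
    rw [div_mul_eq_mul_div, div_lt_iff₀ (by positivity)]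
    nlinarith
  have hq : Tendsto (fun z => (φ t z - σ) / (z - σ)) (angular σ)
      (𝓝 ((Real.exp (-(l * t)) : ℝ) : ℂ)) := by
    rw [Complex.ofReal_exp]
    refine hint.cexp.congr' ?_
    filter_upwards [eventually_angular_mem_disk σ] with z hz
    have hne : z - σ ≠ 0 := by
      rw [← neg_ne_zero, neg_sub]; exact ne_of_mem_disk hσ hz
    rw [h.sub_eq hσ hz ht, mul_div_cancel_left₀ _ hne]
  refine ⟨hσ, ?_, hq⟩
  have h1 := ((tendsto_id_angular σ).sub_const σ).mul hq
  rw [sub_self, zero_mul] at h1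
  have h2 := h1.const_add σ
  rw [add_zero] at h2
  refine h2.congr' ?_
  filter_upwards [eventually_angular_mem_disk σ] with z hz
  have hne : z - σ ≠ 0 := by
    rw [← neg_ne_zero, neg_sub]; exact ne_of_mem_disk hσ hz
  rw [mul_div_cancel₀ _ hne, add_sub_cancel]

/-! ### The Berkson–Porta formula and the Denjoy–Wolff point -/

/-- With `a = ‖τ - z‖` and `b = ‖1 - conj τ * z‖`, the terms in `q` contribute `-(a² + b²) Re q` and
the term in `q'` at most `2 a b Re q`. The sum is at most `-(a - b)² Re q`. -/
theorem isHyperbolicallyContracting_of_eq {τ : ℂ} {q G : ℂ → ℂ} (hq : IsHerglotz q)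
    (hG : ∀ z ∈ disk, G z = (τ - z) * (1 - conj τ * z) * q z) : IsHyperbolicallyContracting G := by
  have hpoly : Differentiable ℂ fun z : ℂ => (τ - z) * (1 - conj τ * z) := by fun_prop
  refine ⟨(hpoly.differentiableOn.mul hq.holo).congr hG, fun z hz => ?_⟩
  have hqz : HasDerivAt q (deriv q z) z :=
    (hq.holo.differentiableAt (isOpen_disk.mem_nhds hz)).hasDerivAt
  have h1 : HasDerivAt (fun z : ℂ => τ - z) (-1) z := (hasDerivAt_id z).const_sub τ
  have h2 : HasDerivAt (fun z : ℂ => 1 - conj τ * z) (-conj τ) z := by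
    simpa using ((hasDerivAt_id z).const_mul (conj τ)).const_sub 1
  have hd := (((h1.mul h2).mul hqz).congr_of_eventuallyEq
    (Filter.eventuallyEq_of_mem (isOpen_disk.mem_nhds hz) hG)).deriv
  simp only [Pi.mul_apply] at hd
  have e : ((1 - ‖z‖ ^ 2 : ℝ) : ℂ) * deriv G z + 2 * conj z * G z
      = ((-(‖τ - z‖ ^ 2 + ‖1 - conj τ * z‖ ^ 2) : ℝ) : ℂ) * q z
        + ((1 - ‖z‖ ^ 2 : ℝ) : ℂ) * ((τ - z) * (1 - conj τ * z) * deriv q z) := by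
    rw [hd, hG z hz]
    push_cast
    simp only [← Complex.mul_conj', map_sub, map_mul, map_one, Complex.conj_conj]
    ring
  have hb := hq.norm_deriv_le hz
  have hz1 := one_sub_norm_sq_pos (mem_disk.1 hz)
  rw [e, Complex.add_re, Complex.re_ofReal_mul, Complex.re_ofReal_mul]
  have h3 : ((τ - z) * (1 - conj τ * z) * deriv q z).re
      ≤ ‖τ - z‖ * ‖1 - conj τ * z‖ * ‖deriv q z‖ := by
    refine (Complex.re_le_norm _).trans ?_
    rw [norm_mul, norm_mul]
  have hq0 := hq.re_nonneg z hz
  set a := ‖τ - z‖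
  set b := ‖1 - conj τ * z‖
  have hab : 0 ≤ a * b := mul_nonneg (norm_nonneg _) (norm_nonneg _)
  have h4 := mul_le_mul_of_nonneg_left h3 hz1.le
  have h5 := mul_le_mul_of_nonneg_left hb hab
  have h6 : 0 ≤ (a - b) ^ 2 * (q z).re := mul_nonneg (sq_nonneg _) hq0
  nlinarith

theorem hasDerivAt_mobius {τ z : ℂ} (hτ : ‖τ‖ ≤ 1) (hz : z ∈ disk) :
    HasDerivAt (fun z => (z - τ) / (1 - conj τ * z))
      (((1 - ‖τ‖ ^ 2 : ℝ) : ℂ) / (1 - conj τ * z) ^ 2) z := by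
  have h1 : HasDerivAt (fun z : ℂ => z - τ) 1 z := (hasDerivAt_id z).sub_const τ
  have h2 : HasDerivAt (fun z : ℂ => 1 - conj τ * z) (-conj τ) z := by
    simpa using ((hasDerivAt_id z).const_mul (conj τ)).const_sub 1
  refine (h1.div h2 (one_sub_conj_mul_ne_zero (mem_disk.1 hz) hτ)).congr_deriv ?_
  congr 1
  push_cast
  rw [← Complex.mul_conj']
  ring

theorem hasDerivAt_cayley {τ z : ℂ} (hτ : ‖τ‖ = 1) (hz : z ∈ disk) :
    HasDerivAt (cayley τ) (2 * τ / (τ - z) ^ 2) z := by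
  have h1 : HasDerivAt (fun z : ℂ => τ + z) 1 z := (hasDerivAt_id z).const_add τ
  have h2 : HasDerivAt (fun z : ℂ => τ - z) (-1) z := (hasDerivAt_id z).const_sub τ
  refine (h1.div h2 (ne_of_mem_disk hτ hz)).congr_deriv ?_
  congr 1
  ring

/-- Derivative of the squared pseudo-hyperbolic distance to `τ` along a trajectory. -/
theorem hasDerivWithinAt_norm_sq_mobius {τ : ℂ} (hτ : ‖τ‖ ≤ 1) {γ : ℝ → ℂ} {s : Set ℝ} {t : ℝ}
    {c : ℂ} (hz : γ t ∈ disk)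
    (hγ : HasDerivWithinAt γ ((τ - γ t) * (1 - conj τ * γ t) * c) s t) :
    HasDerivWithinAt (fun t => ‖(γ t - τ) / (1 - conj τ * γ t)‖ ^ 2)
      (-(2 * (1 - ‖τ‖ ^ 2) * ‖(γ t - τ) / (1 - conj τ * γ t)‖ ^ 2 * c.re)) s t := by
  have hne := one_sub_conj_mul_ne_zero (mem_disk.1 hz) hτ
  have h1 : HasDerivWithinAt (fun t => (γ t - τ) / (1 - conj τ * γ t))
      (((-(1 - ‖τ‖ ^ 2) : ℝ) : ℂ) * c * ((γ t - τ) / (1 - conj τ * γ t))) s t := by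
    refine ((hasDerivAt_mobius hτ hz).comp_hasDerivWithinAt t hγ).congr_deriv ?_
    rw [Complex.ofReal_neg]
    generalize 1 - conj τ * γ t = d at hne
    field_simp
    ring
  refine h1.norm_sq.congr_deriv ?_
  rw [Complex.inner, mul_assoc, Complex.mul_conj, Complex.normSq_eq_norm_sq, mul_assoc,
    Complex.re_ofReal_mul, Complex.re_mul_ofReal]
  ring

/-- Derivative of the Poisson kernel at `τ` along a trajectory. -/
theorem hasDerivWithinAt_re_cayley {τ : ℂ} (hτ : ‖τ‖ = 1) {γ : ℝ → ℂ} {s : Set ℝ} {t : ℝ}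
    {c : ℂ} (hz : γ t ∈ disk)
    (hγ : HasDerivWithinAt γ ((τ - γ t) * (1 - conj τ * γ t) * c) s t) :
    HasDerivWithinAt (fun t => (cayley τ (γ t)).re) (2 * c.re) s t := by
  have hne := ne_of_mem_disk hτ hz
  have h1 : HasDerivWithinAt (fun t => cayley τ (γ t)) (2 * c) s t := by
    refine ((hasDerivAt_cayley hτ hz).comp_hasDerivWithinAt t hγ).congr_deriv ?_
    rw [one_sub_conj_mul_eq hτ]
    have h := conj_mul_self_of_norm_eq_one hτ
    calc 2 * τ / (τ - γ t) ^ 2 * ((τ - γ t) * (conj τ * (τ - γ t)) * c)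
        = 2 * (conj τ * τ) * c * ((τ - γ t) ^ 2 / (τ - γ t) ^ 2) := by ring
      _ = 2 * c := by rw [h, div_self (pow_ne_zero 2 hne)]; ring
  have h2 := (Complex.reCLM.hasFDerivAt (x := cayley τ (γ t))).comp_hasDerivWithinAt t h1
  refine h2.congr_deriv ?_
  simp

theorem norm_deriv_le_one_of_fixed {f : ℂ → ℂ} (hf : DifferentiableOn ℂ f disk)
    (hm : Set.MapsTo f disk disk) {τ : ℂ} (hτ : τ ∈ disk) (hfix : f τ = τ) : ‖deriv f τ‖ ≤ 1 := by
  have hda : HasDerivAt f (deriv f τ) τ :=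
    (hf.differentiableAt (isOpen_disk.mem_nhds hτ)).hasDerivAt
  have hid : Tendsto (fun z : ℂ => z) (𝓝[≠] τ) (𝓝 τ) :=
    tendsto_nhdsWithin_of_tendsto_nhds tendsto_id
  have hcont : Tendsto f (𝓝[≠] τ) (𝓝 (f τ)) := hda.continuousAt.tendsto.mono_left nhdsWithin_le_nhds
  rw [hfix] at hcont
  have h1 : Tendsto (fun z => ‖slope f τ z‖ * ‖1 - conj τ * z‖) (𝓝[≠] τ)
      (𝓝 (‖deriv f τ‖ * ‖1 - conj τ * τ‖)) :=
    (hasDerivAt_iff_tendsto_slope.1 hda).norm.mul ((hid.const_mul _).const_sub _).norm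
  have h2 : Tendsto (fun z => ‖1 - conj τ * f z‖) (𝓝[≠] τ) (𝓝 (‖1 - conj τ * τ‖)) :=
    ((hcont.const_mul _).const_sub _).norm
  have hle := le_of_tendsto_of_tendsto h1 h2 (by
    filter_upwards [self_mem_nhdsWithin, nhdsWithin_le_nhds (isOpen_disk.mem_nhds hτ)] with z hzw hz
    have h := schwarz_pick hf hm hz hτ
    rw [hfix] at h
    have hpos : 0 < ‖z - τ‖ := norm_pos_iff.2 (sub_ne_zero.2 hzw)
    rw [slope_def_field, hfix, norm_div, div_mul_eq_mul_div, div_le_iff₀ hpos]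
    exact h)
  have hpos : 0 < ‖1 - conj τ * τ‖ :=
    norm_pos_iff.2 (one_sub_conj_mul_ne_zero (mem_disk.1 hτ) (mem_disk.1 hτ).le)
  exact le_of_mul_le_mul_right (by rwa [one_mul]) hpos

theorem IsGeneratorOf.apply_eq_of_zero {G : ℂ → ℂ} {φ : ℝ → ℂ → ℂ} (h : IsGeneratorOf G φ) {τ : ℂ}
    (hτ : τ ∈ disk) (h0 : G τ = 0) {t : ℝ} (ht : 0 ≤ t) : φ t τ = τ := by
  have hc : IsTrajectory G t (fun _ => τ) := fun s _ =>
    ⟨hτ, by rw [h0]; exact hasDerivWithinAt_const _ _ _⟩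
  exact (h.isTrajectory hτ t).eqOn h.holo hc (h.semigroup.zero τ hτ) ⟨ht, le_rfl⟩

/-- A generator in Berkson–Porta form with strictly positive Herglotz factor has no fixed points
other than `τ`. -/
theorem IsGeneratorOf.apply_ne {G : ℂ → ℂ} {φ : ℝ → ℂ → ℂ} (h : IsGeneratorOf G φ) {τ : ℂ}
    (hτ : ‖τ‖ ≤ 1) {q : ℂ → ℂ} (hq : ∀ z ∈ disk, 0 < (q z).re)
    (hG : ∀ z ∈ disk, G z = (τ - z) * (1 - conj τ * z) * q z) {t : ℝ} (ht : 0 < t) {w : ℂ}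
    (hw : w ∈ disk) (hwτ : w ≠ τ) : φ t w ≠ w := by
  intro hfix
  have htr := h.isTrajectory hw t
  have hder : ∀ s ∈ Set.Icc 0 t, HasDerivWithinAt (fun s => φ s w)
      ((τ - φ s w) * (1 - conj τ * φ s w) * q (φ s w)) (Set.Icc 0 t) s := fun s hs => by
    rw [← hG _ (htr.mapsTo hs)]; exact (htr s hs).2
  have h0 : (0 : ℝ) ∈ Set.Icc 0 t := ⟨le_rfl, ht.le⟩
  have h1 : t ∈ Set.Icc 0 t := ⟨ht.le, le_rfl⟩
  -- A strictly monotone quantity forbids return: the pseudo-hyperbolic distance to an interior `τ`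
  -- decreases, and the Poisson kernel at a boundary `τ` increases.
  rcases hτ.lt_or_eq with hlt | heq
  · have hτd : τ ∈ disk := mem_disk.2 hlt
    have hGτ : G τ = 0 := by rw [hG τ hτd]; simp
    have hne : ∀ s ∈ Set.Icc 0 t, φ s w - τ ≠ 0 := by
      intro s hs
      have h2 := htr.sub_eq h.holo (h.isTrajectory hτd t) hs
      simp only [h.apply_eq_of_zero hτd hGτ hs.1, h.apply_eq_of_zero hτd hGτ le_rfl,
        h.semigroup.zero w hw] at h2
      rw [h2]
      exact mul_ne_zero (sub_ne_zero.2 hwτ) (Complex.exp_ne_zero _)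
    have hd : ∀ s ∈ Set.Icc 0 t, HasDerivWithinAt _ _ (Set.Icc 0 t) s := fun s hs =>
      hasDerivWithinAt_norm_sq_mobius hτ (htr.mapsTo hs) (hder s hs)
    have hanti := strictAntiOn_of_hasDerivWithinAt_neg (convex_Icc 0 t)
      (fun s hs => (hd s hs).continuousWithinAt)
      (fun s hs => (hd s (interior_subset hs)).mono interior_subset) (fun s hs => by
        have hs' := interior_subset hs
        have hpos : 0 < ‖(φ s w - τ) / (1 - conj τ * φ s w)‖ :=
          norm_pos_iff.2 (div_ne_zero (hne s hs')
            (one_sub_conj_mul_ne_zero (mem_disk.1 (htr.mapsTo hs')) hτ))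
        have h3 := one_sub_norm_sq_pos hlt
        have h4 := hq _ (htr.mapsTo hs')
        have : 0 < 2 * (1 - ‖τ‖ ^ 2) * ‖(φ s w - τ) / (1 - conj τ * φ s w)‖ ^ 2
          * (q (φ s w)).re := by positivity
        linarith)
    have := hanti h0 h1 ht
    simp only [hfix, h.semigroup.zero w hw, lt_irrefl] at this
  · have hd : ∀ s ∈ Set.Icc 0 t, HasDerivWithinAt _ _ (Set.Icc 0 t) s := fun s hs =>
      hasDerivWithinAt_re_cayley heq (htr.mapsTo hs) (hder s hs)
    have hmono := strictMonoOn_of_hasDerivWithinAt_pos (convex_Icc 0 t)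
      (fun s hs => (hd s hs).continuousWithinAt)
      (fun s hs => (hd s (interior_subset hs)).mono interior_subset)
      (fun s hs => mul_pos two_pos (hq _ (htr.mapsTo (interior_subset hs))))
    have := hmono h0 h1 ht
    simp only [hfix, h.semigroup.zero w hw, lt_irrefl] at this

/-- The point `τ` in the Berkson–Porta formula is the Denjoy–Wolff point. -/
theorem IsGeneratorOf.isSemigroupDWPoint {G : ℂ → ℂ} {φ : ℝ → ℂ → ℂ} (h : IsGeneratorOf G φ)
    {τ : ℂ} (hτ : ‖τ‖ ≤ 1) {q : ℂ → ℂ} (hqH : IsHerglotz q) (hq : ∀ z ∈ disk, 0 < (q z).re)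
    (hG : ∀ z ∈ disk, G z = (τ - z) * (1 - conj τ * z) * q z) : IsSemigroupDWPoint φ τ := by
  constructor
  · obtain ⟨w, hw, hwτ⟩ : ∃ w ∈ disk, w ≠ τ := by
      by_cases h0 : τ = 0
      · exact ⟨1 / 2, mem_disk.2 (by norm_num), by rw [h0]; norm_num⟩
      · exact ⟨0, by simp, Ne.symm h0⟩
    exact ⟨1, one_pos, fun he => h.apply_ne hτ hq hG one_pos hw hwτ (he hw)⟩
  · intro t ht _
    rcases hτ.lt_or_eq with hlt | heq
    · have hτd : τ ∈ disk := mem_disk.2 hlt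
      have hfix : φ t τ = τ := h.apply_eq_of_zero hτd (by rw [hG τ hτd]; simp) ht.le
      refine Or.inl ⟨hτd, hfix, fun w hw hww => ?_, ?_⟩
      · by_contra hne
        exact h.apply_ne hτ hq hG ht hw hne hww
      · exact norm_deriv_le_one_of_fixed (h.semigroup.holo t ht.le) (h.semigroup.mapsTo t ht.le)
          hτd hfix
    -- Here `G z / (τ - z) = (1 - conj τ * z) * q z`, so the spectral value at `τ` is `2 * m ≥ 0`
    -- and the angular derivative `exp (-2 m t)` is at most `1`.
    · obtain ⟨m, hm0, -, hm⟩ := hqH.exists_star heq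
      have hsv : HasSpectralValue G τ (2 * m) := by
        have h1 : Tendsto (fun z => (1 - conj τ * z) * q z) (angular τ) (𝓝 ((2 * m : ℝ) : ℂ)) := by
          push_cast; exact hm
        refine h1.congr' ?_
        filter_upwards [eventually_angular_mem_disk τ] with z hz
        rw [hG z hz, mul_assoc, mul_div_cancel_left₀ _ (ne_of_mem_disk heq hz)]
      refine Or.inr ⟨fun w hw => h.apply_ne hτ hq hG ht hw fun he => ?_, _,
        h.hasBRFPWithDeriv heq hsv ht.le, ?_⟩
      · rw [he, mem_disk] at hw
        exact hw.ne heq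
      · exact Real.exp_le_one_iff.2 (neg_nonpos.2 (by positivity))

/-- **Julia's lemma** at a boundary regular fixed point with angular derivative at most one. -/
theorem HasBRFPWithDeriv.re_cayley_le {f : ℂ → ℂ} (hf : DifferentiableOn ℂ f disk)
    (hm : Set.MapsTo f disk disk) {τ : ℂ} {a : ℝ} (h : HasBRFPWithDeriv f τ a) (ha : a ≤ 1)
    {z : ℂ} (hz : z ∈ disk) : (cayley τ z).re ≤ (cayley τ (f z)).re := by
  have hτ := h.norm_eq
  have hP : IsHerglotz (fun z => cayley τ (f z)) :=
    ⟨(differentiableOn_cayley hτ).comp hf hm, fun z hz => (re_cayley_pos hτ (hm hz)).le⟩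
  obtain ⟨m, hm0, hH, hs⟩ := hP.exists_star hτ
  -- Multiplying the star limit of `cayley τ ∘ f` by the angular derivative gives `m * a = 1`, hence
  -- `m ≥ 1`; the claim is then positivity of the real part after removing the atom.
  have hprod := hs.mul h.angularDeriv
  have hlim : Tendsto (fun z => conj τ * (τ + f z)) (angular τ) (𝓝 (conj τ * (τ + τ))) :=
    (h.fixed.const_add _).const_mul _
  rw [mul_add, conj_mul_self_of_norm_eq_one hτ, one_add_one_eq_two] at hlim
  have := angular_neBot hτ
  have heq : 2 * (m : ℂ) * a = 2 := by
    refine tendsto_nhds_unique hprod (hlim.congr' ?_)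
    filter_upwards [eventually_angular_mem_disk τ] with w hw
    have h1 := ne_of_mem_disk hτ hw
    have h2 := ne_of_mem_disk hτ (hm hw)
    have e1 : f w - τ = -(τ - f w) := by ring
    have e2 : w - τ = -(τ - w) := by ring
    rw [one_sub_conj_mul_eq hτ, cayley, e1, e2, neg_div_neg_eq]
    field_simp
  have hma : m * a = 1 := by
    have : 2 * m * a = 2 := by exact_mod_cast heq
    linarith
  have hm1 : 1 ≤ m := by nlinarith
  have h3 := hH.re_nonneg z hz
  rw [Complex.sub_re, Complex.re_ofReal_mul] at h3
  nlinarith [re_cayley_pos hτ hz]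

theorem hasDerivWithinAt_nonneg_of_le {g : ℝ → ℝ} {g' : ℝ}
    (hg : HasDerivWithinAt g g' (Set.Ici 0) 0) (hle : ∀ s, 0 ≤ s → g 0 ≤ g s) : 0 ≤ g' := by
  have h : Tendsto (slope g 0) (𝓝[>] 0) (𝓝 g') :=
    (hasDerivWithinAt_iff_tendsto_slope' Set.self_notMem_Ioi).1 (hg.mono Set.Ioi_subset_Ici_self)
  refine ge_of_tendsto h ?_
  filter_upwards [self_mem_nhdsWithin] with s hs
  rw [slope_def_field, sub_zero]
  exact div_nonneg (sub_nonneg.2 (hle s (le_of_lt hs))) (le_of_lt hs)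

/-- The **Berkson–Porta formula**. -/
theorem IsGeneratorOf.exists_herglotz {G : ℂ → ℂ} {φ : ℝ → ℂ → ℂ} (h : IsGeneratorOf G φ) {τ : ℂ}
    (hτ : ‖τ‖ ≤ 1) (hDW : IsSemigroupDWPoint φ τ) :
    ∃ q, IsHerglotz q ∧ ∀ z ∈ disk, G z = (τ - z) * (1 - conj τ * z) * q z := by
  rcases hτ.lt_or_eq with hlt | heq
  · have hτd : τ ∈ disk := mem_disk.2 hlt
    have hfix : ∀ t, 0 ≤ t → φ t τ = τ := by
      intro t ht
      rcases ht.eq_or_lt with rfl | ht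
      · exact h.semigroup.zero τ hτd
      by_cases hid : Set.EqOn (φ t) id disk
      · exact hid hτd
      · rcases hDW.2 t ht hid with h1 | h1
        · exact h1.2.1
        · obtain ⟨-, a, ha, -⟩ := h1
          exact absurd ha.norm_eq hlt.ne
    have hGτ : G τ = 0 := by
      have h1 := h.flow τ hτd 0 le_rfl
      have h2 : HasDerivWithinAt (fun s => φ s τ) 0 (Set.Ici 0) 0 :=
        (hasDerivWithinAt_const (0 : ℝ) (Set.Ici 0) τ).congr (fun s hs => hfix s hs)
          (hfix 0 le_rfl)
      have h3 := (uniqueDiffWithinAt_Ici (0 : ℝ)).eq_deriv _ h1 h2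
      rwa [hfix 0 le_rfl] at h3
    -- Since `G τ = 0`, the factor `z - τ` divides out; `dslope` keeps the quotient holomorphic at
    -- `τ`.
    set q : ℂ → ℂ := fun z => -dslope G τ z / (1 - conj τ * z) with hqdef
    have hqd : DifferentiableOn ℂ q disk := by
      refine DifferentiableOn.div ?_ (by fun_prop) fun z hz =>
        one_sub_conj_mul_ne_zero (mem_disk.1 hz) hτ
      exact ((Complex.differentiableOn_dslope (isOpen_disk.mem_nhds hτd)).2 h.holo).neg
    have hGq : ∀ z ∈ disk, G z = (τ - z) * (1 - conj τ * z) * q z := by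
      intro z hz
      have h1 := sub_smul_dslope G τ z
      rw [hGτ, sub_zero, smul_eq_mul] at h1
      have h2 := one_sub_conj_mul_ne_zero (mem_disk.1 hz) hτ
      rw [hqdef, mul_assoc, mul_div_cancel₀ _ h2, ← h1]
      ring
    -- By Schwarz–Pick the distance to `τ` does not exceed its value at time `0`; its derivative
    -- there gives the sign of `Re q`. The point `τ` itself is covered by continuity.
    have hpos : ∀ z ∈ disk, z ≠ τ → 0 ≤ (q z).re := by
      intro z hz hne
      have hz0 := h.semigroup.zero z hz
      have hd := hasDerivWithinAt_norm_sq_mobius hτ (γ := fun s => φ s z) (t := 0) (c := q z)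
        (s := Set.Ici 0) (by rw [hz0]; exact hz) (by
          have h1 := h.flow z hz 0 le_rfl
          rw [hz0] at h1 ⊢
          rwa [← hGq z hz])
      have h1 := hasDerivWithinAt_nonneg_of_le hd.neg fun s hs => by
        simp only [Pi.neg_apply, neg_le_neg_iff]
        rw [hz0]
        have h2 := schwarz_pick (h.semigroup.holo s hs) (h.semigroup.mapsTo s hs) hz hτd
        rw [hfix s hs] at h2
        have p1 := norm_pos_iff.2 (one_sub_conj_mul_ne_zero (mem_disk.1 hz) hτ)
        have p2 := norm_pos_iff.2 (one_sub_conj_mul_ne_zero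
          (mem_disk.1 (h.semigroup.mapsTo s hs hz)) hτ)
        refine pow_le_pow_left₀ (norm_nonneg _) ?_ 2
        rw [norm_div, norm_div, div_le_div_iff₀ p2 p1]
        linarith
      rw [neg_neg, hz0] at h1
      have h3 : 0 < 2 * (1 - ‖τ‖ ^ 2) * ‖(z - τ) / (1 - conj τ * z)‖ ^ 2 := by
        have := norm_pos_iff.2 (div_ne_zero (sub_ne_zero.2 hne)
          (one_sub_conj_mul_ne_zero (mem_disk.1 hz) hτ))
        have := one_sub_norm_sq_pos hlt
        positivity
      exact nonneg_of_mul_nonneg_right h1 h3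
    refine ⟨q, ⟨hqd, fun z hz => ?_⟩, hGq⟩
    by_cases hne : z = τ
    · subst hne
      have hc : Tendsto (fun w => (q w).re) (𝓝[≠] z) (𝓝 (q z).re) :=
        (Complex.continuous_re.tendsto _).comp
          ((hqd.differentiableAt (isOpen_disk.mem_nhds hz)).continuousAt.tendsto.mono_left
            nhdsWithin_le_nhds)
      refine ge_of_tendsto hc ?_
      filter_upwards [self_mem_nhdsWithin, nhdsWithin_le_nhds (isOpen_disk.mem_nhds hz)] with w h1 h2
      exact hpos w h2 h1
    · exact hpos z hz hne
  · have hne : ∀ z ∈ disk, (τ - z) * (1 - conj τ * z) ≠ 0 := fun z hz =>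
      mul_ne_zero (ne_of_mem_disk heq hz) (one_sub_conj_mul_ne_zero (mem_disk.1 hz) hτ)
    have hGq : ∀ z ∈ disk, G z = (τ - z) * (1 - conj τ * z) * (G z / ((τ - z) * (1 - conj τ * z))) :=
      fun z hz => (mul_div_cancel₀ _ (hne z hz)).symm
    refine ⟨_, ⟨h.holo.div (by fun_prop) hne, fun z hz => ?_⟩, hGq⟩
    have hz0 := h.semigroup.zero z hz
    -- For `τ` on the circle, Julia's lemma plays the role of Schwarz–Pick.
    have hd := hasDerivWithinAt_re_cayley heq (γ := fun s => φ s z) (t := 0)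
      (c := G z / ((τ - z) * (1 - conj τ * z)))
      (s := Set.Ici 0) (by rw [hz0]; exact hz) (by
        have h1 := h.flow z hz 0 le_rfl
        rw [hz0] at h1 ⊢
        rwa [← hGq z hz])
    have h1 := hasDerivWithinAt_nonneg_of_le hd fun s hs => by
      rw [hz0]
      rcases hs.eq_or_lt with rfl | hs
      · rw [hz0]
      by_cases hid : Set.EqOn (φ s) id disk
      · rw [hid hz]; rfl
      · rcases hDW.2 s hs hid with h1 | h1
        · exact absurd heq (mem_disk.1 h1.1).ne
        · obtain ⟨-, a, ha, ha1⟩ := h1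
          exact ha.re_cayley_le (h.semigroup.holo s hs.le) (h.semigroup.mapsTo s hs.le) ha1 hz
    simp only [Pi.div_apply]
    linarith

/-! ### Removing atoms and reading off spectral values -/

/-- Finitely many atoms can be removed simultaneously from a Herglotz function. -/
theorem IsHerglotz.sub_sum_cayley {ι : Type*} {P : ℂ → ℂ} (hP : IsHerglotz P) {σ : ι → ℂ}
    (hσ : ∀ k, ‖σ k‖ = 1) (hinj : Function.Injective σ) {a m : ι → ℝ} (ham : ∀ k, a k ≤ m k)
    (hstar : ∀ k, HasStar P (σ k) (2 * m k)) (s : Finset ι) :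
    IsHerglotz (fun z => P z - ∑ k ∈ s, (a k : ℂ) * cayley (σ k) z) := by
  classical
  induction s using Finset.induction_on with
  | empty => simpa using hP
  | insert j s hj ih =>
    -- The terms already removed have their poles away from `σ j`, so they do not affect the star
    -- limit there.
    have hcont : ContinuousAt (fun z => -∑ k ∈ s, (a k : ℂ) * cayley (σ k) z) (σ j) := by
      refine ContinuousAt.neg (tendsto_finsetSum _ fun k hk => ?_)
      refine Tendsto.const_mul _ (continuousAt_cayley fun he => hj ?_).tendsto
      rwa [hinj he]
    have h1 := (hstar j).add (hasStar_zero_of_continuousAt (hσ j) hcont)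
    simp only [← sub_eq_add_neg, add_zero] at h1
    obtain ⟨m', -, hH, hs⟩ := ih.exists_star (hσ j)
    have := angular_neBot (hσ j)
    have hm' : m' = m j := by
      have h2 := tendsto_nhds_unique hs h1
      have h3 : 2 * m' = 2 * m j := by exact_mod_cast h2
      linarith
    have h4 := hH.add ((isHerglotz_cayley (hσ j)).ofReal_mul (a := m' - a j)
      (by rw [hm']; linarith [ham j]))
    convert h4 using 2 with z
    rw [Finset.sum_insert hj]
    push_cast
    ring

/-- The duality behind the theorem: the quotient defining the atom of `P` and the one defining the
spectral value of `G` multiply to a polynomial, so each limit determines the other. -/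
theorem mul_div_sub_eq {τ σ P G z : ℂ} (hσ : ‖σ‖ = 1) (hz : z ∈ disk) (hP : P ≠ 0)
    (hG : G = (τ - z) * (1 - conj τ * z) / P) :
    (1 - conj σ * z) * P * (G / (σ - z)) = conj σ * ((τ - z) * (1 - conj τ * z)) := by
  have h1 := ne_of_mem_disk hσ hz
  rw [one_sub_conj_mul_eq hσ, hG]
  generalize (τ - z) * (1 - conj τ * z) = N
  field_simp

/-- On the circle `conj σ * (1 - conj τ * σ) = conj (σ - τ)`. -/
theorem tendsto_conj_mul_angular (τ : ℂ) {σ : ℂ} (hσ : ‖σ‖ = 1) :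
    Tendsto (fun z => conj σ * ((τ - z) * (1 - conj τ * z))) (angular σ)
      (𝓝 ((-‖τ - σ‖ ^ 2 : ℝ) : ℂ)) := by
  have h : Tendsto (fun z => conj σ * ((τ - z) * (1 - conj τ * z))) (𝓝 σ)
      (𝓝 (conj σ * ((τ - σ) * (1 - conj τ * σ)))) := Continuous.tendsto (by fun_prop) σ
  have e : conj σ * ((τ - σ) * (1 - conj τ * σ)) = ((-‖τ - σ‖ ^ 2 : ℝ) : ℂ) := by
    push_cast
    rw [← Complex.mul_conj', map_sub]
    linear_combination (-(τ - σ) * conj τ) * conj_mul_self_of_norm_eq_one hσ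
  rw [← e]
  exact h.mono_left (angular_le_nhds σ)

/-- Relation between the spectral value of `G` and the atom of the denominator of `G`. -/
theorem HasSpectralValue.mul_eq {τ σ : ℂ} {G P : ℂ → ℂ} {m l : ℝ} (hσ : ‖σ‖ = 1)
    (hP : ∀ z ∈ disk, P z ≠ 0) (hG : ∀ z ∈ disk, G z = (τ - z) * (1 - conj τ * z) / P z)
    (hm : HasStar P σ (2 * m)) (hl : HasSpectralValue G σ l) : 2 * m * l = -‖τ - σ‖ ^ 2 := by
  have := angular_neBot hσ
  have h := tendsto_nhds_unique (hm.mul hl) ((tendsto_conj_mul_angular τ hσ).congr' (by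
    filter_upwards [eventually_angular_mem_disk σ] with z hz
    exact (mul_div_sub_eq hσ hz (hP z hz) (hG z hz)).symm))
  exact_mod_cast h

/-- A positive atom of the denominator is what makes the spectral value finite. -/
theorem HasStar.hasSpectralValue {τ σ : ℂ} {G P : ℂ → ℂ} {m : ℝ} (hσ : ‖σ‖ = 1)
    (hP : ∀ z ∈ disk, P z ≠ 0) (hG : ∀ z ∈ disk, G z = (τ - z) * (1 - conj τ * z) / P z)
    (hm : HasStar P σ (2 * m)) (hm0 : 0 < m) :
    HasSpectralValue G σ (-‖τ - σ‖ ^ 2 / (2 * m)) := by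
  have h := (tendsto_conj_mul_angular τ hσ).div hm (by simpa using hm0.ne')
  have e : ((-‖τ - σ‖ ^ 2 : ℝ) : ℂ) / (2 * m) = ((-‖τ - σ‖ ^ 2 / (2 * m) : ℝ) : ℂ) := by
    push_cast; rfl
  rw [e] at h
  refine h.congr' ?_
  filter_upwards [eventually_angular_mem_disk σ] with z hz
  have h1 : (1 - conj σ * z) * P z ≠ 0 :=
    mul_ne_zero (one_sub_conj_mul_ne_zero (mem_disk.1 hz) hσ.le) (hP z hz)
  simp only [Pi.div_apply]
  rw [← mul_div_sub_eq hσ hz (hP z hz) (hG z hz), mul_div_cancel_left₀ _ h1]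

/-! ### The representation formula -/

section Representation

variable {n : ℕ} {τ : ℂ} {σ : Fin n → ℂ} {lam : Fin n → ℝ}

theorem alpha_pos {τ σ : ℂ} (h : τ ≠ σ) {l : ℝ} (hl : l < 0) : 0 < alpha τ σ l := by
  have h1 := norm_pos_iff.2 (sub_ne_zero.2 h)
  have h2 := abs_pos.2 hl.ne
  unfold alpha
  positivity

theorem two_mul_alpha_mul {τ σ : ℂ} {l : ℝ} (hl : l < 0) :
    2 * alpha τ σ l * l = -‖τ - σ‖ ^ 2 := by
  have := hl.ne
  rw [alpha, abs_of_neg hl]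
  field_simp

theorem p0_eq_sum_cayley (z : ℂ) :
    p0 τ σ lam z = ∑ k, (alpha τ (σ k) (lam k) : ℂ) * cayley (σ k) z := rfl

theorem differentiableOn_p0 (hσ : ∀ k, ‖σ k‖ = 1) : DifferentiableOn ℂ (p0 τ σ lam) disk := by
  have : p0 τ σ lam = fun z => ∑ k, (alpha τ (σ k) (lam k) : ℂ) * cayley (σ k) z := rfl
  rw [this]
  exact DifferentiableOn.fun_sum fun k _ => (differentiableOn_cayley (hσ k)).const_mul _

theorem re_p0_pos (hn : 1 ≤ n) (hσ : ∀ k, ‖σ k‖ = 1) (hτσ : ∀ k, τ ≠ σ k) (hlam : ∀ k, lam k < 0)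
    {z : ℂ} (hz : z ∈ disk) : 0 < (p0 τ σ lam z).re := by
  rw [p0_eq_sum_cayley, Complex.re_sum]
  refine Finset.sum_pos (fun k _ => ?_) ⟨⟨0, hn⟩, Finset.mem_univ _⟩
  rw [Complex.re_ofReal_mul]
  exact mul_pos (alpha_pos (hτσ k) (hlam k)) (re_cayley_pos (hσ k) hz)

theorem hasStar_p0 (hσ : ∀ k, ‖σ k‖ = 1) (hσinj : Function.Injective σ) (j : Fin n) :
    HasStar (p0 τ σ lam) (σ j) (2 * alpha τ (σ j) (lam j)) := by
  have hcont : ContinuousAt (fun z => ∑ k ∈ Finset.univ.erase j,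
      (alpha τ (σ k) (lam k) : ℂ) * cayley (σ k) z) (σ j) := by
    refine tendsto_finsetSum _ fun k hk => ?_
    refine Tendsto.const_mul _ (continuousAt_cayley fun he => ?_).tendsto
    exact Finset.ne_of_mem_erase hk (hσinj he).symm
  have h := ((hasStar_cayley_self (hσ j)).const_mul (alpha τ (σ j) (lam j))).add
    (hasStar_zero_of_continuousAt (hσ j) hcont)
  rw [add_zero, mul_comm] at h
  convert h using 2 with z
  rw [p0_eq_sum_cayley]
  exact (Finset.add_sum_erase _ _ (Finset.mem_univ j)).symm

/-- The denominator in the representation formula. -/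
theorem isHerglotz_add_p0 (hn : 1 ≤ n) (hσ : ∀ k, ‖σ k‖ = 1) (hτσ : ∀ k, τ ≠ σ k)
    (hlam : ∀ k, lam k < 0) {p : ℂ → ℂ} (hp : IsHerglotz p) :
    IsHerglotz (fun z => p z + p0 τ σ lam z) :=
  hp.add ⟨differentiableOn_p0 hσ, fun _ hz => (re_p0_pos hn hσ hτσ hlam hz).le⟩

theorem re_add_p0_pos (hn : 1 ≤ n) (hσ : ∀ k, ‖σ k‖ = 1) (hτσ : ∀ k, τ ≠ σ k)
    (hlam : ∀ k, lam k < 0) {p : ℂ → ℂ} (hp : IsHerglotz p) {z : ℂ} (hz : z ∈ disk) :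
    0 < (p z + p0 τ σ lam z).re := by
  rw [Complex.add_re]
  linarith [hp.re_nonneg z hz, re_p0_pos hn hσ hτσ hlam hz]

theorem add_p0_ne_zero (hn : 1 ≤ n) (hσ : ∀ k, ‖σ k‖ = 1) (hτσ : ∀ k, τ ≠ σ k)
    (hlam : ∀ k, lam k < 0) {p : ℂ → ℂ} (hp : IsHerglotz p) {z : ℂ} (hz : z ∈ disk) :
    p z + p0 τ σ lam z ≠ 0 := fun h => by
  have := re_add_p0_pos hn hσ hτσ hlam hp hz
  rw [h, Complex.zero_re] at this
  exact lt_irrefl _ this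

theorem IsHerglotz.inv {q : ℂ → ℂ} (hq : IsHerglotz q) (h0 : ∀ z ∈ disk, q z ≠ 0) :
    IsHerglotz (fun z => (q z)⁻¹) :=
  ⟨hq.holo.inv h0, fun z hz => by
    rw [Complex.inv_re]; exact div_nonneg (hq.re_nonneg z hz) (Complex.normSq_nonneg _)⟩

theorem exists_represents_of_mem_gen (hτ : ‖τ‖ ≤ 1) (hσ : ∀ k, ‖σ k‖ = 1)
    (hσinj : Function.Injective σ) (hlam : ∀ k, lam k < 0) {G : ℂ → ℂ}
    (hG : G ∈ Gen τ σ lam) (hG0 : ¬ Set.EqOn G 0 disk) :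
    ∃ p, IsHerglotz p ∧ Represents τ σ lam p G := by
  obtain ⟨φ, hφ, hDW, hk⟩ := hG
  obtain ⟨q, hq, hGq⟩ := hφ.exists_herglotz hτ (hDW.resolve_left hG0)
  have hq0 : ∀ z ∈ disk, q z ≠ 0 := fun z hz h0 => hG0 fun w hw => by
    rw [hGq w hw, hq.eqOn_zero hz h0 hw]; simp
  have hP := hq.inv hq0
  have hGP : ∀ z ∈ disk, G z = (τ - z) * (1 - conj τ * z) / (q z)⁻¹ := fun z hz => by
    rw [hGq z hz, div_inv_eq_mul]
  have hm : ∀ k, ∃ m : ℝ, alpha τ (σ k) (lam k) ≤ m ∧ HasStar (fun z => (q z)⁻¹) (σ k) (2 * m) := by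
    intro k
    obtain ⟨m, hm0, -, hm⟩ := hP.exists_star (hσ k)
    obtain ⟨-, l, hl, hl1, hl2⟩ := hk k
    refine ⟨m, ?_, hm⟩
    -- Both `2 m l` and `2 α λ` equal `-‖τ - σ k‖ ^ 2`, so `λ ≤ l ≤ 0` forces `α ≤ m`.
    have h1 := hl.mul_eq (hσ k) (fun z hz => inv_ne_zero (hq0 z hz)) hGP hm
    have h2 := two_mul_alpha_mul (τ := τ) (σ := σ k) (hlam k)
    by_contra hlt
    push Not at hlt
    have h3 : m * (-l) ≤ m * (-lam k) := mul_le_mul_of_nonneg_left (by linarith) hm0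
    have h4 : m * (-lam k) < alpha τ (σ k) (lam k) * (-lam k) :=
      mul_lt_mul_of_pos_right hlt (by linarith [hlam k])
    linarith
  choose m hm1 hm2 using hm
  refine ⟨_, hP.sub_sum_cayley hσ hσinj hm1 hm2 Finset.univ, fun z hz => ?_⟩
  simp only [← p0_eq_sum_cayley, sub_add_cancel]
  exact hGP z hz

theorem Represents.not_eqOn_zero (hn : 1 ≤ n) (hσ : ∀ k, ‖σ k‖ = 1) (hτσ : ∀ k, τ ≠ σ k)
    (hlam : ∀ k, lam k < 0) {p G : ℂ → ℂ} (hp : IsHerglotz p) (hG : Represents τ σ lam p G)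
    (hτ : ‖τ‖ ≤ 1) : ¬ Set.EqOn G 0 disk := by
  intro h0
  obtain ⟨w, hw, hwτ⟩ : ∃ w ∈ disk, w ≠ τ := by
    by_cases h : τ = 0
    · exact ⟨1 / 2, mem_disk.2 (by norm_num), by rw [h]; norm_num⟩
    · exact ⟨0, by simp, Ne.symm h⟩
  have h1 := h0 hw
  rw [hG w hw] at h1
  exact div_ne_zero (mul_ne_zero (sub_ne_zero.2 hwτ.symm)
    (one_sub_conj_mul_ne_zero (mem_disk.1 hw) hτ)) (add_p0_ne_zero hn hσ hτσ hlam hp hw) h1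

theorem Represents.mem_gen (hn : 1 ≤ n) (hτ : ‖τ‖ ≤ 1) (hσ : ∀ k, ‖σ k‖ = 1)
    (hσinj : Function.Injective σ) (hτσ : ∀ k, τ ≠ σ k) (hlam : ∀ k, lam k < 0) {p G : ℂ → ℂ}
    (hp : IsHerglotz p) (hG : Represents τ σ lam p G) : G ∈ Gen τ σ lam := by
  have hne : ∀ z ∈ disk, p z + p0 τ σ lam z ≠ 0 := fun z hz => add_p0_ne_zero hn hσ hτσ hlam hp hz
  have hq := (isHerglotz_add_p0 hn hσ hτσ hlam hp).inv hne
  have hqpos : ∀ z ∈ disk, 0 < ((p z + p0 τ σ lam z)⁻¹).re := fun z hz => by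
    rw [Complex.inv_re]
    exact div_pos (re_add_p0_pos hn hσ hτσ hlam hp hz) (Complex.normSq_pos.2 (hne z hz))
  have hGq : ∀ z ∈ disk, G z = (τ - z) * (1 - conj τ * z) * (p z + p0 τ σ lam z)⁻¹ :=
    fun z hz => by rw [hG z hz, div_eq_mul_inv]
  obtain ⟨φ, hφ⟩ := (isHyperbolicallyContracting_of_eq hq hGq).exists_isGeneratorOf
  refine ⟨φ, hφ, Or.inr (hφ.isSemigroupDWPoint hτ hq hqpos hGq), fun k => ?_⟩
  obtain ⟨m, hm0, -, hm⟩ := hp.exists_star (hσ k)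
  have ha := alpha_pos (hτσ k) (hlam k)
  have hs : HasStar (fun z => p z + p0 τ σ lam z) (σ k)
      (2 * ((m + alpha τ (σ k) (lam k) : ℝ) : ℂ)) := by
    have := hm.add (hasStar_p0 (τ := τ) (lam := lam) hσ hσinj k)
    rw [← mul_add] at this
    exact_mod_cast this
  have hsv := hs.hasSpectralValue (hσ k) hne hG (by linarith)
  refine ⟨fun t ht => ⟨_, hφ.hasBRFPWithDeriv (hσ k) hsv ht⟩, _, hsv, ?_, ?_⟩
  -- Enlarging the atom from `α` to `m + α` only moves the spectral value from `λ` towards `0`.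
  · have h2 := two_mul_alpha_mul (τ := τ) (σ := σ k) (hlam k)
    rw [le_div_iff₀ (by linarith), ← h2]
    nlinarith [hlam k]
  · exact div_nonpos_of_nonpos_of_nonneg (by nlinarith [sq_nonneg ‖τ - σ k‖]) (by linarith)

/-- The spectral values attain the prescribed bounds exactly when `p` has no atoms at the `σ k`. -/
theorem Represents.hasSpectralValue_iff (hn : 1 ≤ n) (hσ : ∀ k, ‖σ k‖ = 1)
    (hσinj : Function.Injective σ) (hτσ : ∀ k, τ ≠ σ k) (hlam : ∀ k, lam k < 0) {p G : ℂ → ℂ}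
    (hp : IsHerglotz p) (hG : Represents τ σ lam p G) (k : Fin n) :
    HasSpectralValue G (σ k) (lam k) ↔ HasStar p (σ k) 0 := by
  have hne : ∀ z ∈ disk, p z + p0 τ σ lam z ≠ 0 := fun z hz => add_p0_ne_zero hn hσ hτσ hlam hp hz
  have ha := alpha_pos (hτσ k) (hlam k)
  have h2 := two_mul_alpha_mul (τ := τ) (σ := σ k) (hlam k)
  have hp0 := hasStar_p0 (τ := τ) (lam := lam) hσ hσinj k
  constructor
  · intro hl
    obtain ⟨m, hm0, -, hm⟩ := hp.exists_star (hσ k)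
    have hs : HasStar (fun z => p z + p0 τ σ lam z) (σ k)
        (2 * ((m + alpha τ (σ k) (lam k) : ℝ) : ℂ)) := by
      have := hm.add hp0
      rw [← mul_add] at this
      exact_mod_cast this
    have h1 := hl.mul_eq (hσ k) hne hG hs
    have h3 : m * lam k = 0 := by linarith
    have h4 : m = 0 := (mul_eq_zero.1 h3).resolve_right (hlam k).ne
    simpa [h4] using hm
  · intro h0
    have hs := h0.add hp0
    rw [zero_add] at hs
    have hsv := hs.hasSpectralValue (hσ k) hne hG ha
    rwa [← h2, mul_div_cancel_left₀ _ (by positivity)] at hsv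

end Representation

end DiskSemigroup

/-! ### The main theorem -/

theorem mainTheorem1 {n : ℕ} (hn : 1 ≤ n) (τ : ℂ) (hτ : ‖τ‖ ≤ 1)
    (σ : Fin n → ℂ) (hσ : ∀ k, ‖σ k‖ = 1) (hσinj : Function.Injective σ)
    (hτσ : ∀ k, τ ≠ σ k) (lam : Fin n → ℝ) (hlam : ∀ k, lam k < 0) (G : ℂ → ℂ) :
    ((G ∈ DiskSemigroup.Gen τ σ lam ∧ ¬ Set.EqOn G 0 DiskSemigroup.disk) ↔
      ∃ p : ℂ → ℂ, DiskSemigroup.IsHerglotz p ∧ DiskSemigroup.Represents τ σ lam p G) ∧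
    (G ∈ DiskSemigroup.Gen' τ σ lam ↔
      ∃ p : ℂ → ℂ, DiskSemigroup.IsHerglotz p ∧ DiskSemigroup.Represents τ σ lam p G ∧
        ∀ k, DiskSemigroup.HasStar p (σ k) 0) := by
  constructor
  · constructor
    · rintro ⟨hG, hG0⟩
      exact DiskSemigroup.exists_represents_of_mem_gen hτ hσ hσinj hlam hG hG0
    · rintro ⟨p, hp, hG⟩
      exact ⟨hG.mem_gen hn hτ hσ hσinj hτσ hlam hp, hG.not_eqOn_zero hn hσ hτσ hlam hp hτ⟩
  · constructor
    · rintro ⟨hG, hl⟩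
      -- The zero generator has spectral value `0` at every `σ k`; as `n ≥ 1` and `lam k < 0`, it is
      -- excluded from `Gen'`.
      have hG0 : ¬ Set.EqOn G 0 DiskSemigroup.disk := fun h0 => by
        have := DiskSemigroup.angular_neBot (hσ ⟨0, hn⟩)
        have h1 : Tendsto (fun z => G z / (σ ⟨0, hn⟩ - z)) (DiskSemigroup.angular (σ ⟨0, hn⟩))
            (𝓝 0) := by
          refine tendsto_const_nhds.congr' ?_
          filter_upwards [DiskSemigroup.eventually_angular_mem_disk (σ ⟨0, hn⟩)] with z hz
          simp [h0 hz]
        have h2 := tendsto_nhds_unique (hl ⟨0, hn⟩) h1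
        exact (hlam ⟨0, hn⟩).ne (by exact_mod_cast h2)
      obtain ⟨p, hp, hR⟩ :=
        DiskSemigroup.exists_represents_of_mem_gen hτ hσ hσinj hlam hG hG0
      exact ⟨p, hp, hR, fun k => (hR.hasSpectralValue_iff hn hσ hσinj hτσ hlam hp k).1 (hl k)⟩
    · rintro ⟨p, hp, hR, hs⟩
      exact ⟨hR.mem_gen hn hτ hσ hσinj hτσ hlam hp, fun k =>
        (hR.hasSpectralValue_iff hn hσ hσinj hτσ hlam hp k).2 (hs k)⟩
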